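/- Let $\mu$ be a (positive Borel) measure on $\mathbb C$ with $\mu(B(x,r))\le r$ for all $x\in\mathbb C$, $r>0$, where $B(x,r)=\{y:|x-y|<r\}$. Let $\varepsilon>0$ and let $K(x,y)$, $x\ne y$, be a complex-valued Calderón–Zygmund kernel: $|K(x,y)|\le \frac1{|x-y|}$ for $x\neq y$, and $$|K(x,y)-K(x',y)|,\ |K(y,x)-K(y,x')|\le\frac{|x-x'|^{\varepsilon}}{|x-y|^{1+\varepsilon}}\quad\text{whenever } x\ne y,\ |x-x'|\le\tfrac12|x-y|.$$ Assume that the operator $T\varphi(x)=\int_{\mathbb C}K(x,y)\varphi(y)\,d\mu(y)$ is bounded in $L^2(\mu)$, i.e. $T$ is a bounded linear operator on $L^2(\mu)$ such that, whenever $\varphi\in L^2(\mu)$ vanishes $\mu$-a.e. outside a compact set $S$, the formula $T\varphi(x)=\int K(x,y)\varphi(y)\,d\mu(y)$ holds for $\mu$-almost every $x\notin S$. For a finite signed measure $\nu$ on $\mathbb C$ put $$T^\sharp\nu(x)=\sup_{r>0}|T_r\nu(x)|,\qquad T_r\nu(x)=\int_{\mathbb C\setminus B(x,r)}K(x,y)\,d\nu(y).$$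 Then there is a constant $A$, depending only on $\varepsilon$ and $\|T\|_{L^2(\mu)\to L^2(\mu)}$, such that for every finite signed measure $\nu$ on $\mathbb C$, with total variation $\|\nu\|$, and every $t>0$, $$\mu\{x\in\mathbb C: |T^\sharp\nu(x)|>t\}\le\frac{A\|\nu\|}{t}.$$ -/

import Mathlib

open MeasureTheory Set
open scoped ENNReal

/-- The Ahlfors condition (linear growth): `μ (B(x, r)) ≤ r` for all `x ∈ ℂ` and `r > 0`,
where `B(x, r)` is the open disk. -/
def AhlforsCondition (μ : Measure ℂ) : Prop :=
  ∀ (x : ℂ) (r : ℝ), 0 < r → μ (Metric.ball x r) ≤ ENNReal.ofReal r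

/-- `K` is a Calderón–Zygmund kernel of dimension one on `ℂ` with smoothness exponent `ε` and
constants equal to one. The values of `K` on the diagonal are irrelevant. -/
structure IsCalderonZygmundKernel (ε : ℝ) (K : ℂ → ℂ → ℂ) : Prop where
  size : ∀ x y : ℂ, x ≠ y → ‖K x y‖ ≤ 1 / ‖x - y‖
  smooth_left : ∀ x x' y : ℂ, x ≠ y → ‖x - x'‖ ≤ ‖x - y‖ / 2 →
    ‖K x y - K x' y‖ ≤ ‖x - x'‖ ^ ε / ‖x - y‖ ^ (1 + ε)
  smooth_right : ∀ x x' y : ℂ, x ≠ y → ‖x - x'‖ ≤ ‖x - y‖ / 2 →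
    ‖K y x - K y x'‖ ≤ ‖x - x'‖ ^ ε / ‖x - y‖ ^ (1 + ε)

/-- The bounded operator `T` on `L²(μ)` is given by the kernel `K`: whenever `φ ∈ L²(μ)` vanishes
outside a compact set `S`, one has `Tφ(x) = ∫ K(x, y) φ(y) dμ(y)` for `μ`-almost every `x ∉ S`
(on `S` the integral need not converge; off `S` it converges absolutely). -/
def HasKernel (μ : Measure ℂ) (K : ℂ → ℂ → ℂ) (T : Lp ℂ 2 μ →L[ℂ] Lp ℂ 2 μ) : Prop :=
  ∀ (φ : Lp ℂ 2 μ) (S : Set ℂ), IsCompact S → (∀ᵐ x ∂μ, x ∉ S → φ x = 0) →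
    ∀ᵐ x ∂μ, x ∉ S → T φ x = ∫ y, K x y * φ y ∂μ

/-- The truncated singular integral of a signed measure,
`T_r ν(x) = ∫_{ℂ \ B(x, r)} K(x, y) dν(y)`. -/
noncomputable def truncatedOp (K : ℂ → ℂ → ℂ) (r : ℝ) (ν : SignedMeasure ℂ) (x : ℂ) : ℂ :=
  ∫ᵛ y in (Metric.ball x r)ᶜ, K x y ∂<•ν

/-- The maximal singular operator on signed measures, `T^♯ ν(x) = sup_{r > 0} |T_r ν(x)|`,
with values in `[0, ∞]`. -/
noncomputable def maximalOp (K : ℂ → ℂ → ℂ) (ν : SignedMeasure ℂ) (x : ℂ) : ℝ≥0∞ :=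
  ⨆ (r : ℝ) (_ : 0 < r), ‖truncatedOp K r ν x‖ₑ

/-! Since `μ` need not be doubling, linear growth has to do the work of doubling, in the spirit of
Nazarov, Treil and Volberg. Its key consequence is `exists_doubling_radius`. Around a point, the
mass cannot grow by the factor `40 ^ 2` at every step of ratio 40, so some larger scale `R` is
doubling. Below the first such `R` the mass decays so fast towards the center that the annuli
contribute a geometric series to the Riesz potential.

Weak type (2,2): at a given point, a truncation at `r` is moved to `2 * R` at bounded cost, compared
with `T` of the far part at nearby points, and averaged over the doubling ball
(`enorm_truncation_le_of_dominated`). This leaves local averages of `|f|²` and `|Tf|²`. Their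
denominators are five-fold enlarged balls, so Vitali's covering lemma controls them without doubling
(`maximal_weak_type`).

Weak type (1,1): let `ν` be a finite sum of atoms. The set where `ν` is not dominated by `l * μ` has
measure at most `ν univ / l`. Each atom is spread over a subset of its doubling ball so that the
total density is `O(l)` (`exists_stopping_radii`, `exists_bounded_overlap_sets`). The spread mass is
a bounded function with L¹ norm at most `ν univ`, and the weak (2,2) bound gives `l² μ{…} ≤ C l
ν(univ)`. Replacing atoms by their spreads costs an integrable error, proportional to the mass of
each atom, and a boundary term `O(l)` on the good set.

Finite measures are limits of their push-forwards under simple functions, and signed measures are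
handled by the Jordan decomposition. No constant depends on the number of atoms. -/

open scoped NNReal

/-! ### Covering, tail and majorant estimates. -/

/-- The averaged maximal function with enlarged denominators is of weak type `(1, 1)`. -/
theorem maximal_weak_type (μ σ : Measure ℂ) (l : ℝ≥0∞) :
    l * μ {x | ∃ r : ℝ, 0 < r ∧ l * μ (Metric.ball x (5 * r)) < σ (Metric.ball x r)} ≤
      σ univ := by
  -- Vitali's lemma needs bounded radii. The sets `S n` increase, and continuity of `μ` along
  -- increasing unions needs no measurability.
  set S : ℕ → Set ℂ := fun n => {x | ∃ r : ℝ, 0 < r ∧ r ≤ n ∧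
    l * μ (Metric.ball x (5 * r)) < σ (Metric.ball x r)} with hS
  have hunion : {x | ∃ r : ℝ, 0 < r ∧ l * μ (Metric.ball x (5 * r)) < σ (Metric.ball x r)} =
      ⋃ n, S n := by
    ext x
    simp only [hS, mem_ofPred_eq, mem_iUnion]
    constructor
    · rintro ⟨r, h0, h⟩
      obtain ⟨n, hn⟩ := exists_nat_ge r
      exact ⟨n, r, h0, hn, h⟩
    · rintro ⟨n, r, h0, -, h⟩
      exact ⟨r, h0, h⟩
  have hmono : Monotone S := by
    rintro m n hmn x ⟨r, h0, h1, h2⟩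
    exact ⟨r, h0, h1.trans (by exact_mod_cast hmn), h2⟩
  rw [hunion, hmono.measure_iUnion, ENNReal.mul_iSup]
  refine iSup_le fun n => ?_
  choose! r hr0 hrn hr using fun x (hx : x ∈ S n) => hx
  -- The five-fold balls cover `S n` while the original balls are disjoint: the former are measured
  -- by `μ`, the latter by `σ`.
  obtain ⟨u, hut, hdisj, hcov⟩ := Vitali.exists_disjoint_subfamily_covering_enlargement_ball
    (S n) id r n hrn 5 (by norm_num)
  have hcount : u.Countable := by
    refine hdisj.countable_of_isOpen (fun a _ => Metric.isOpen_ball) fun a ha => ?_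
    exact Metric.nonempty_ball.2 (hr0 a (hut ha))
  have hsub : S n ⊆ ⋃ b ∈ u, Metric.ball b (5 * r b) := by
    intro x hx
    obtain ⟨b, hb, hsub⟩ := hcov x hx
    exact mem_biUnion hb (hsub (Metric.mem_ball_self (hr0 x hx)))
  calc l * μ (S n) ≤ l * ∑' b : u, μ (Metric.ball (b : ℂ) (5 * r b)) := by
        gcongr
        exact (measure_mono hsub).trans (measure_biUnion_le _ hcount _)
    _ = ∑' b : u, l * μ (Metric.ball (b : ℂ) (5 * r b)) := ENNReal.tsum_mul_left.symm
    _ ≤ ∑' b : u, σ (Metric.ball (b : ℂ) (r b)) :=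
        ENNReal.tsum_le_tsum fun b => (hr b (hut b.2)).le
    _ = σ (⋃ b ∈ u, Metric.ball b (r b)) :=
        (measure_biUnion hcount hdisj fun _ _ => measurableSet_ball).symm
    _ ≤ σ univ := measure_mono (subset_univ _)

theorem compl_ball_subset_iUnion_annuli {x : ℂ} {s : ℝ} (hs : 0 < s) :
    (Metric.ball x s)ᶜ ⊆
      ⋃ k : ℕ, Metric.ball x (2 ^ (k + 1) * s) \ Metric.ball x (2 ^ k * s) := by
  intro y hy
  simp only [mem_compl_iff, Metric.mem_ball, not_lt] at hy
  have h1 : 1 ≤ dist y x / s := by rwa [le_div_iff₀ hs, one_mul]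
  obtain ⟨n, hn1, hn2⟩ := exists_nat_pow_near h1 (one_lt_two)
  rw [le_div_iff₀ hs] at hn1
  rw [div_lt_iff₀ hs] at hn2
  exact mem_iUnion.2 ⟨n, by simpa using hn2, by simpa using hn1⟩

/-- The geometric constant of the tail estimate for kernels of smoothness `ε`. -/
noncomputable def tailConst (ε : ℝ) : ℝ≥0∞ :=
  ∑' k : ℕ, ENNReal.ofReal (2 * (2 : ℝ) ^ (-(ε * k)))

theorem tailConst_ne_top {ε : ℝ} (hε : 0 < ε) : tailConst ε ≠ ∞ := by
  have h : ∀ k : ℕ, 2 * (2 : ℝ) ^ (-(ε * k)) = 2 * ((2 : ℝ) ^ (-ε)) ^ k := by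
    intro k
    rw [← Real.rpow_natCast, ← Real.rpow_mul (by norm_num)]
    ring_nf
  have hs : Summable fun k : ℕ => 2 * (2 : ℝ) ^ (-(ε * k)) := by
    simp_rw [h]
    refine (summable_geometric_of_lt_one (by positivity) ?_).mul_left 2
    exact Real.rpow_lt_one_of_one_lt_of_neg (by norm_num) (by linarith)
  rw [tailConst, ← ENNReal.ofReal_tsum_of_nonneg (fun k => by positivity) hs]
  exact ENNReal.ofReal_ne_top

/-- Tail estimate for measures of linear growth at scales above `s`. -/
theorem lintegral_tail_le (σ : Measure ℂ) (x : ℂ) {ε s : ℝ} (hε : 0 < ε) (hs : 0 < s)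
    (Λ : ℝ≥0∞) (h : ∀ r, s ≤ r → σ (Metric.ball x r) ≤ Λ * ENNReal.ofReal r) :
    ∫⁻ y in (Metric.ball x s)ᶜ, ENNReal.ofReal (s ^ ε / ‖x - y‖ ^ (1 + ε)) ∂σ ≤
      tailConst ε * Λ := by
  calc _ ≤ ∫⁻ y in ⋃ k : ℕ, Metric.ball x (2 ^ (k + 1) * s) \ Metric.ball x (2 ^ k * s),
        ENNReal.ofReal (s ^ ε / ‖x - y‖ ^ (1 + ε)) ∂σ :=
      lintegral_mono_set (compl_ball_subset_iUnion_annuli hs)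
    _ ≤ ∑' k : ℕ, ∫⁻ y in Metric.ball x (2 ^ (k + 1) * s) \ Metric.ball x (2 ^ k * s),
        ENNReal.ofReal (s ^ ε / ‖x - y‖ ^ (1 + ε)) ∂σ := lintegral_iUnion_le _ _
    -- On the `k`-th annulus the integrand is at most `s^ε / (2^k s)^(1+ε)` and the mass at most `Λ
    -- 2^(k+1) s`.
    _ ≤ ∑' k : ℕ, ENNReal.ofReal (2 * (2 : ℝ) ^ (-(ε * k))) * Λ := by
      refine ENNReal.tsum_le_tsum fun k => ?_
      have hk : 0 < (2 : ℝ) ^ k * s := by positivity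
      calc _ ≤ ∫⁻ y in Metric.ball x (2 ^ (k + 1) * s) \ Metric.ball x (2 ^ k * s),
            ENNReal.ofReal (s ^ ε / (2 ^ k * s) ^ (1 + ε)) ∂σ := by
            refine setLIntegral_mono' (measurableSet_ball.diff measurableSet_ball) fun y hy => ?_
            have hy2 : 2 ^ k * s ≤ ‖x - y‖ := by
              simpa [dist_comm y x, dist_eq_norm] using hy.2
            gcongr
        _ ≤ ENNReal.ofReal (s ^ ε / (2 ^ k * s) ^ (1 + ε)) *
            (Λ * ENNReal.ofReal (2 ^ (k + 1) * s)) := by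
            rw [setLIntegral_const]
            gcongr
            refine (measure_mono sdiff_subset).trans (h _ ?_)
            have : (1 : ℝ) ≤ 2 ^ (k + 1) := one_le_pow₀ (by norm_num)
            nlinarith
        _ = ENNReal.ofReal (2 * (2 : ℝ) ^ (-(ε * k))) * Λ := by
            rw [mul_comm Λ, ← mul_assoc, ← ENNReal.ofReal_mul (by positivity)]
            congr 2
            rw [Real.mul_rpow (by positivity) hs.le, ← Real.rpow_natCast, ← Real.rpow_natCast,
              ← Real.rpow_mul (by norm_num), Real.rpow_add hs, Real.rpow_one, Real.rpow_neg (by norm_num),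
              show (k : ℝ) * (1 + ε) = k + ε * k by ring, Real.rpow_add (by norm_num)]
            push_cast
            rw [Real.rpow_add (by norm_num), Real.rpow_one]
            have : 0 < (2:ℝ) ^ (k:ℝ) := by positivity
            have : 0 < (2:ℝ) ^ (ε * k:ℝ) := by positivity
            have : 0 < s ^ ε := by positivity
            field_simp
    _ = tailConst ε * Λ := ENNReal.tsum_mul_right

theorem sq_lintegral_le {α : Type*} [MeasurableSpace α] (ρ : Measure α) {g : α → ℝ≥0∞}
    (hg : AEMeasurable g ρ) : (∫⁻ x, g x ∂ρ) ^ 2 ≤ ρ univ * ∫⁻ x, g x ^ 2 ∂ρ := by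
  have h := ENNReal.lintegral_mul_le_Lp_mul_Lq ρ (Real.HolderConjugate.two_two) hg
    (aemeasurable_const (b := (1 : ℝ≥0∞)))
  simp only [Pi.mul_apply, mul_one, ENNReal.one_rpow, lintegral_const, one_mul] at h
  calc (∫⁻ x, g x ∂ρ) ^ 2 ≤ _ := pow_le_pow_left' h 2
    _ = ρ univ * ∫⁻ x, g x ^ 2 ∂ρ := by
      rw [mul_pow, ← ENNReal.rpow_natCast, ← ENNReal.rpow_mul, ← ENNReal.rpow_natCast,
        ← ENNReal.rpow_mul]
      norm_num
      rw [mul_comm]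

/-- A function of weak type has a measurable majorant with controlled integral. -/
theorem exists_measurable_majorant (μ : Measure ℂ) (F : ℂ → ℝ≥0∞) (B : Set ℂ)
    (c D : ℝ≥0∞) (hc : c ≠ 0) (hc' : c ≠ ∞)
    (h : ∀ l : ℝ≥0∞, l ≠ 0 → l ≠ ∞ → l ^ 2 * μ {x | l < F x} ≤ D) :
    ∃ H : ℂ → ℝ≥0∞, Measurable H ∧ (∀ x, F x ≤ H x) ∧
      ∫⁻ x in B, H x ∂μ ≤ c * μ B + 2 * (D / c) := by
  -- `F` will be a supremum over uncountably many radii, so its level sets are replaced by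
  -- measurable hulls of the same measure.
  set E : ℕ → Set ℂ := fun k => toMeasurable μ {x | 2 ^ k * c < F x} with hE
  have hEm : ∀ k, MeasurableSet (E k) := fun k => measurableSet_toMeasurable _ _
  refine ⟨fun x => c + ∑' k : ℕ, (E k).indicator (fun _ => 2 ^ k * c) x, ?_, ?_, ?_⟩
  · exact measurable_const.add (Measurable.tsum fun k => measurable_const.indicator (hEm k))
  · intro x
    -- The levels telescope: `c + (c + 2c + … + 2^n c) = 2^(n+1) c`, which bounds `F x` when `n + 1`
    -- is the first level not exceeded.
    have key : ∀ n : ℕ, 2 ^ n * c < F x → 2 ^ (n + 1) * c ≤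
        c + ∑ k ∈ Finset.range (n + 1), (E k).indicator (fun _ => 2 ^ k * c) x := by
      intro n
      induction n with
      | zero =>
        intro hn
        have : x ∈ E 0 := subset_toMeasurable _ _ hn
        simp [this, two_mul]
      | succ n ih =>
        intro hn
        have hx : x ∈ E (n + 1) := subset_toMeasurable _ _ hn
        have hlt : 2 ^ n * c < F x := lt_of_le_of_lt (by gcongr <;> simp) hn
        rw [Finset.sum_range_succ, ← add_assoc, indicator_of_mem hx]
        calc 2 ^ (n + 1 + 1) * c = 2 ^ (n + 1) * c + 2 ^ (n + 1) * c := by ring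
          _ ≤ _ := by gcongr; exact ih hlt
    refine le_of_forall_lt fun a ha => ?_
    by_cases hex : ∃ n : ℕ, F x ≤ 2 ^ n * c
    · classical
      obtain ⟨hn, hmin⟩ := Nat.find_spec hex, fun m hm => Nat.find_min hex (m := m) hm
      rcases hm : Nat.find hex with _ | m
      · rw [hm] at hn
        refine ha.trans_le (hn.trans ?_)
        simp
      · have := hmin m (by omega)
        rw [hm] at hn
        refine ha.trans_le (hn.trans ((key m (not_le.1 this)).trans ?_))
        exact add_le_add le_rfl (ENNReal.sum_le_tsum _)
    · push Not at hex
      have hat : a ≠ ∞ := ne_top_of_lt ha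
      have : ∃ n : ℕ, a < 2 ^ (n + 1) * c := by
        have hac : a / c ≠ ∞ := ENNReal.div_ne_top hat hc
        obtain ⟨n, hn⟩ := ENNReal.exists_nat_gt hac
        refine ⟨n, ?_⟩
        rw [← ENNReal.div_lt_iff (Or.inl hc) (Or.inl hc')]
        refine hn.trans_le ?_
        exact_mod_cast (Nat.lt_two_pow_self.le.trans (Nat.pow_le_pow_right (by norm_num) (Nat.le_succ n)))
      obtain ⟨n, hn⟩ := this
      refine hn.trans_le ((key n (hex n)).trans ?_)
      exact add_le_add le_rfl (ENNReal.sum_le_tsum _)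
  · have hmE : ∀ k, Measurable ((E k).indicator fun _ => 2 ^ k * c) :=
      fun k => measurable_const.indicator (hEm k)
    rw [lintegral_add_left measurable_const, setLIntegral_const,
      lintegral_tsum fun k => (hmE k).aemeasurable]
    gcongr
    -- The quadratic decay of the distribution function leaves a factor `2^(-k)` after
    -- multiplication by the height `2^k c`.
    have hk : ∀ k : ℕ, ∫⁻ x in B, (E k).indicator (fun _ => 2 ^ k * c) x ∂μ ≤
        (2⁻¹) ^ k * (D / c) := by
      intro k
      have h2 : (2 : ℝ≥0∞) ^ k ≠ 0 := by positivity
      have h2' : (2 : ℝ≥0∞) ^ k ≠ ∞ := by finiteness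
      have hne : 2 ^ k * c ≠ 0 := mul_ne_zero h2 hc
      have hne' : 2 ^ k * c ≠ ∞ := ENNReal.mul_ne_top h2' hc'
      calc _ ≤ ∫⁻ x, (E k).indicator (fun _ => 2 ^ k * c) x ∂μ := setLIntegral_le_lintegral _ _
        _ = 2 ^ k * c * μ {x | 2 ^ k * c < F x} := by
          rw [lintegral_indicator_const (hEm k), measure_toMeasurable]
        _ ≤ D / (2 ^ k * c) := by
          rw [ENNReal.le_div_iff_mul_le (Or.inl hne) (Or.inl hne')]
          refine le_trans (le_of_eq ?_) (h _ hne hne')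
          ring
        _ = (2⁻¹) ^ k * (D / c) := by
          simp only [div_eq_mul_inv]
          rw [ENNReal.mul_inv (Or.inl h2) (Or.inl h2'), ← ENNReal.inv_pow]
          ring
    refine (ENNReal.tsum_le_tsum hk).trans (le_of_eq ?_)
    rw [ENNReal.tsum_mul_right, ENNReal.tsum_geometric]
    norm_num

/-! ### Doubling scales for measures of linear growth. -/

/-- Above every scale `s` there is a doubling scale `R`; the part of a dominated measure between
both scales has a bounded Riesz potential at the center. -/
theorem exists_doubling_radius {μ : Measure ℂ} (hμ : AhlforsCondition μ) (x : ℂ) {s : ℝ}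
    (hs : 0 < s) (hpos : μ (Metric.ball x s) ≠ 0) :
    ∃ R, s ≤ R ∧ μ (Metric.ball x (40 * R)) ≤ 1600 * μ (Metric.ball x R) ∧
      ∀ (σ : Measure ℂ) (Λ : ℝ≥0∞),
        (∀ r, s ≤ r → σ (Metric.ball x r) ≤ Λ * μ (Metric.ball x (40 * r))) →
        ∫⁻ y in Metric.ball x R \ Metric.ball x s, ENNReal.ofReal (1 / ‖x - y‖) ∂σ ≤
          40 ^ 4 * Λ := by
  set m : ℕ → ℝ≥0∞ := fun j => μ (Metric.ball x (40 ^ j * s)) with hm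
  set S : ℝ≥0∞ := ENNReal.ofReal s with hS
  have hmS : ∀ j, m j ≤ 40 ^ j * S := by
    intro j
    refine (hμ x _ (by positivity)).trans (le_of_eq ?_)
    rw [ENNReal.ofReal_mul (by positivity), ENNReal.ofReal_pow (by norm_num)]
    norm_num [hS]
  have h40 : ∀ j : ℕ, (40 : ℝ≥0∞) ^ j ≠ 0 := fun j => by positivity
  have h40' : ∀ j : ℕ, (40 : ℝ≥0∞) ^ j ≠ ∞ := fun j => by finiteness
  -- Otherwise `m j` would grow at least like `1600^j`, against the upper bound `40^j * S`;
  -- positivity of `m 0` makes this a contradiction.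
  have hex : ∃ k, m (k + 1) ≤ 1600 * m k := by
    by_contra! hcon
    have hgrow : ∀ j : ℕ, 1600 ^ j * m 0 ≤ m j := by
      intro j
      induction j with
      | zero => simp
      | succ j ih =>
        calc 1600 ^ (j + 1) * m 0 = 1600 * (1600 ^ j * m 0) := by ring
          _ ≤ 1600 * m j := by gcongr
          _ ≤ m (j + 1) := (hcon j).le
    have hb : ∀ j : ℕ, 40 ^ j * m 0 ≤ S := by
      intro j
      rw [← ENNReal.mul_le_mul_iff_right (h40 j) (h40' j)]
      calc 40 ^ j * (40 ^ j * m 0) = 1600 ^ j * m 0 := by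
            rw [← mul_assoc, ← mul_pow]; norm_num
        _ ≤ 40 ^ j * S := (hgrow j).trans (hmS j)
    have hm0 : m 0 ≠ 0 := by simpa [hm] using hpos
    have : S / m 0 ≠ ∞ := ENNReal.div_ne_top ENNReal.ofReal_ne_top hm0
    obtain ⟨n, hn⟩ := ENNReal.exists_nat_gt this
    have hm0' : m 0 ≠ ∞ := ne_top_of_le_ne_top (by finiteness) (hmS 0)
    rw [ENNReal.div_lt_iff (Or.inl hm0) (Or.inl hm0')] at hn
    refine absurd (hn.trans_le ?_) (not_lt.2 (hb n))
    gcongr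
    exact_mod_cast (Nat.lt_pow_self (by norm_num : 1 < 40)).le
  classical
  obtain ⟨k, hk, hmin⟩ : ∃ k, m (k + 1) ≤ 1600 * m k ∧ ∀ j < k, 1600 * m j ≤ m (j + 1) :=
    ⟨Nat.find hex, Nat.find_spec hex, fun j hj => (not_le.1 (Nat.find_min hex hj)).le⟩
  -- Downward induction from `m k ≤ 40^k * S`: each step towards the center gains `1600 = 40^2`, so
  -- `m i ≤ 40^(2 * i - k) * S`.
  have hlow : ∀ d i, i + d = k → 40 ^ k * m i ≤ 40 ^ (2 * i) * S := by
    intro d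
    induction d with
    | zero =>
      intro i hi
      obtain rfl : i = k := by simpa using hi
      calc 40 ^ i * m i ≤ 40 ^ i * (40 ^ i * S) := by gcongr; exact hmS i
        _ = 40 ^ (2 * i) * S := by ring
    | succ d ih =>
      intro i hi
      rw [← ENNReal.mul_le_mul_iff_right (h40 2) (h40' 2)]
      calc 40 ^ 2 * (40 ^ k * m i) = 40 ^ k * (1600 * m i) := by ring
        _ ≤ 40 ^ k * m (i + 1) := by gcongr; exact hmin i (by omega)
        _ ≤ 40 ^ (2 * (i + 1)) * S := ih (i + 1) (by omega)
        _ = 40 ^ 2 * (40 ^ (2 * i) * S) := by ring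
  -- The index `k + 1` is needed because the outermost annulus, `n = k - 1`, is bounded through `m
  -- (n + 2)`. A factor 40 is given away.
  have hle : ∀ i ≤ k + 1, 40 ^ k * m i ≤ 40 ^ (2 * i) * S := by
    intro i hi
    rcases Nat.lt_or_ge k i with h | h
    · obtain rfl : i = k + 1 := by omega
      calc 40 ^ k * m (k + 1) ≤ 40 ^ k * (40 ^ (k + 1) * S) := by gcongr; exact hmS _
        _ = 40 ^ (2 * k + 1) * S := by ring
        _ ≤ 40 ^ (2 * (k + 1)) * S := by
          gcongr
          · norm_num
          · omega
    · exact hlow (k - i) i (by omega)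
  have hsk : ∀ j : ℕ, s ≤ 40 ^ j * s := fun j => by
    have : (1 : ℝ) ≤ 40 ^ j := one_le_pow₀ (by norm_num)
    nlinarith
  refine ⟨40 ^ k * s, hsk k, ?_, fun σ Λ hσ => ?_⟩
  · have : 40 * (40 ^ k * s) = 40 ^ (k + 1) * s := by ring
    rw [this]
    exact hk
  · have hind : ∀ n ≤ k, 40 ^ k * ∫⁻ y in Metric.ball x (40 ^ n * s) \ Metric.ball x s,
        ENNReal.ofReal (1 / ‖x - y‖) ∂σ ≤ 40 ^ (n + 4) * Λ := by
      intro n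
      induction n with
      | zero => simp
      | succ n ih =>
        intro hn
        have hns : 0 < 40 ^ n * s := by positivity
        -- The annulus contributes at most `Λ * m (n + 2) / (40^n s) ≤ 40^(n + 4 - k) * Λ`, the
        -- general term of a geometric series dominated by its last one.
        have hstep : 40 ^ k * ∫⁻ y in Metric.ball x (40 ^ (n + 1) * s) \
            Metric.ball x (40 ^ n * s), ENNReal.ofReal (1 / ‖x - y‖) ∂σ ≤ 40 ^ (n + 4) * Λ := by
          have hq : ENNReal.ofReal (1 / (40 ^ n * s)) * (40 ^ n * S) = 1 := by
            have : (40 : ℝ≥0∞) ^ n * S = ENNReal.ofReal (40 ^ n * s) := by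
              rw [ENNReal.ofReal_mul (by positivity), ENNReal.ofReal_pow (by norm_num)]
              norm_num [hS]
            rw [this, ← ENNReal.ofReal_mul (by positivity), one_div, inv_mul_cancel₀ hns.ne',
              ENNReal.ofReal_one]
          calc _ ≤ 40 ^ k * ∫⁻ y in Metric.ball x (40 ^ (n + 1) * s) \
                Metric.ball x (40 ^ n * s), ENNReal.ofReal (1 / (40 ^ n * s)) ∂σ := by
                gcongr 40 ^ k * ?_
                refine setLIntegral_mono' (measurableSet_ball.diff measurableSet_ball)
                  fun y hy => ?_
                have hy2 : 40 ^ n * s ≤ ‖x - y‖ := by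
                  simpa [dist_comm y x, dist_eq_norm] using hy.2
                gcongr
            _ ≤ 40 ^ k * (ENNReal.ofReal (1 / (40 ^ n * s)) * (Λ * m (n + 2))) := by
                rw [setLIntegral_const]
                gcongr
                refine (measure_mono sdiff_subset).trans ((hσ _ (hsk _)).trans (le_of_eq ?_))
                simp only [hm]
                congr 3
                ring
            _ = ENNReal.ofReal (1 / (40 ^ n * s)) * Λ * (40 ^ k * m (n + 2)) := by ring
            _ ≤ ENNReal.ofReal (1 / (40 ^ n * s)) * Λ * (40 ^ (2 * (n + 2)) * S) := by
                exact mul_le_mul' le_rfl (hle (n + 2) (by omega))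
            _ = 40 ^ (n + 4) * Λ * (ENNReal.ofReal (1 / (40 ^ n * s)) * (40 ^ n * S)) := by ring
            _ = 40 ^ (n + 4) * Λ := by rw [hq, mul_one]
        calc _ ≤ 40 ^ k * ((∫⁻ y in Metric.ball x (40 ^ n * s) \ Metric.ball x s,
                ENNReal.ofReal (1 / ‖x - y‖) ∂σ) + ∫⁻ y in Metric.ball x (40 ^ (n + 1) * s) \
                Metric.ball x (40 ^ n * s), ENNReal.ofReal (1 / ‖x - y‖) ∂σ) := by
              gcongr
              refine (lintegral_mono_set ?_).trans (lintegral_union_le _ _ _)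
              intro y hy
              by_cases h : y ∈ Metric.ball x (40 ^ n * s)
              · exact Or.inl ⟨h, hy.2⟩
              · exact Or.inr ⟨hy.1, h⟩
          _ ≤ 40 ^ (n + 4) * Λ + 40 ^ (n + 4) * Λ := by
              rw [mul_add]
              exact add_le_add (ih (by omega)) hstep
          _ = 2 * (40 ^ (n + 4) * Λ) := by ring
          _ ≤ 40 * (40 ^ (n + 4) * Λ) := by gcongr; norm_num
          _ = 40 ^ (n + 1 + 4) * Λ := by ring
    rw [← ENNReal.mul_le_mul_iff_right (h40 k) (h40' k)]
    refine (hind k le_rfl).trans (le_of_eq ?_)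
    ring

theorem AhlforsCondition.isLocallyFiniteMeasure {μ : Measure ℂ} (hμ : AhlforsCondition μ) :
    IsLocallyFiniteMeasure μ :=
  ⟨fun x => ⟨Metric.ball x 1, Metric.ball_mem_nhds x one_pos,
    (hμ x 1 one_pos).trans_lt ENNReal.ofReal_lt_top⟩⟩

theorem AhlforsCondition.measure_ball_ne_top {μ : Measure ℂ} (hμ : AhlforsCondition μ) (x : ℂ)
    (r : ℝ) : μ (Metric.ball x r) ≠ ∞ := by
  rcases le_or_gt r 0 with hr | hr
  · simp [Metric.ball_eq_empty.2 hr]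
  · exact ne_top_of_le_ne_top ENNReal.ofReal_ne_top (hμ x r hr)

/-- Points having a null ball form a locally null set, hence a null set as the plane is second
countable. -/
theorem ae_measure_ball_ne_zero (μ : Measure ℂ) :
    ∀ᵐ x ∂μ, ∀ r : ℝ, 0 < r → μ (Metric.ball x r) ≠ 0 := by
  rw [ae_iff]
  refine measure_null_of_locally_null _ fun x hx => ?_
  simp only [not_forall, mem_ofPred_eq, not_not] at hx
  obtain ⟨r, hr, h0⟩ := hx
  exact ⟨Metric.ball x r, mem_nhdsWithin_of_mem_nhds (Metric.ball_mem_nhds x hr), h0⟩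

/-! ### Measurability and size of the kernel. -/

namespace IsCalderonZygmundKernel

variable {ε : ℝ} {K : ℂ → ℂ → ℂ}

/-- Joint measurability of `K` is not assumed; smoothness in the second variable supplies all the
measurability that the integrals need. -/
theorem continuousOn_compl_singleton (hK : IsCalderonZygmundKernel ε K) (hε : 0 < ε) (x : ℂ) :
    ContinuousOn (K x) {x}ᶜ := by
  intro y hy
  refine ContinuousAt.continuousWithinAt ?_
  have hyx : y ≠ x := hy
  have hd : 0 < ‖y - x‖ := norm_pos_iff.2 (sub_ne_zero.2 hyx)
  rw [ContinuousAt, tendsto_iff_norm_sub_tendsto_zero]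
  have hlim : Filter.Tendsto (fun z => ‖y - z‖ ^ ε / ‖y - x‖ ^ (1 + ε)) (nhds y) (nhds 0) := by
    have : ContinuousAt (fun z => ‖y - z‖ ^ ε / ‖y - x‖ ^ (1 + ε)) y := by
      refine ContinuousAt.div_const (ContinuousAt.rpow_const (by fun_prop) (Or.inr hε.le)) _
    have h2 := this.tendsto
    simpa [Real.zero_rpow hε.ne'] using h2
  refine squeeze_zero' (Filter.Eventually.of_forall fun z => norm_nonneg _) ?_ hlim
  filter_upwards [Metric.ball_mem_nhds y (half_pos hd)] with z hz
  rw [norm_sub_rev]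
  refine hK.smooth_right y z x hyx ?_
  rw [← dist_eq_norm, dist_comm]
  exact (Metric.mem_ball.1 hz).le

theorem aestronglyMeasurable (hK : IsCalderonZygmundKernel ε K) (hε : 0 < ε) (x : ℂ) {r : ℝ}
    (hr : 0 < r) (σ : Measure ℂ) :
    AEStronglyMeasurable (K x) (σ.restrict (Metric.ball x r)ᶜ) := by
  refine ((hK.continuousOn_compl_singleton hε x).mono ?_).aestronglyMeasurable
    measurableSet_ball.compl
  exact compl_subset_compl.2 (singleton_subset_iff.2 (Metric.mem_ball_self hr))

theorem norm_le_of_notMem_ball (hK : IsCalderonZygmundKernel ε K) {x y : ℂ} {r : ℝ} (hr : 0 < r)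
    (hy : y ∉ Metric.ball x r) : ‖K x y‖ ≤ 1 / r := by
  have h : r ≤ ‖x - y‖ := by simpa [dist_comm y x, dist_eq_norm] using hy
  have hxy : x ≠ y := by
    rintro rfl
    simp at h
    linarith
  exact (hK.size x y hxy).trans (by gcongr)

theorem integrableOn (hK : IsCalderonZygmundKernel ε K) (hε : 0 < ε) (x : ℂ) {r : ℝ}
    (hr : 0 < r) (σ : Measure ℂ) [IsFiniteMeasure σ] :
    IntegrableOn (K x) (Metric.ball x r)ᶜ σ := by
  refine Integrable.of_bound (hK.aestronglyMeasurable hε x hr σ) (1 / r) ?_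
  filter_upwards [ae_restrict_mem measurableSet_ball.compl] with y hy
  exact hK.norm_le_of_notMem_ball hr hy

theorem integrableOn_mul (hK : IsCalderonZygmundKernel ε K) (hε : 0 < ε) (x : ℂ) {r : ℝ}
    (hr : 0 < r) {σ : Measure ℂ} {f : ℂ → ℂ} (hf : Integrable f σ) :
    IntegrableOn (fun y => K x y * f y) (Metric.ball x r)ᶜ σ := by
  refine Integrable.bdd_mul (c := 1 / r) hf.integrableOn (hK.aestronglyMeasurable hε x hr σ) ?_
  filter_upwards [ae_restrict_mem measurableSet_ball.compl] with y hy
  exact hK.norm_le_of_notMem_ball hr hy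

theorem enorm_le (hK : IsCalderonZygmundKernel ε K) {x y : ℂ} (h : x ≠ y) :
    ‖K x y‖ₑ ≤ ENNReal.ofReal (1 / ‖x - y‖) := by
  rw [← ofReal_norm]
  exact ENNReal.ofReal_le_ofReal (hK.size x y h)

end IsCalderonZygmundKernel

theorem setLIntegral_mul_enorm_eq {μ : Measure ℂ} {f : ℂ → ℂ} (hf : Measurable f)
    {g : ℂ → ℝ≥0∞} (hg : Measurable g) {s : Set ℂ} (hs : MeasurableSet s) :
    ∫⁻ y in s, g y * ‖f y‖ₑ ∂μ = ∫⁻ y in s, g y ∂(μ.withDensity fun y => ‖f y‖ₑ) := by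
  rw [setLIntegral_withDensity_eq_setLIntegral_mul _ hf.enorm hg hs]
  simp only [Pi.mul_apply, mul_comm]

theorem lintegral_enorm_sq_apply_le {μ : Measure ℂ} (T : Lp ℂ 2 μ →L[ℂ] Lp ℂ 2 μ) {f : ℂ → ℂ}
    (hf : MemLp f 2 μ) :
    ∫⁻ x, ‖T (hf.toLp f) x‖ₑ ^ 2 ∂μ ≤ ‖T‖ₑ ^ 2 * ∫⁻ x, ‖f x‖ₑ ^ 2 ∂μ := by
  have key : ∀ g : ℂ → ℂ, eLpNorm g 2 μ ^ 2 = ∫⁻ x, ‖g x‖ₑ ^ 2 ∂μ := fun g => by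
    simpa using eLpNorm_nnreal_pow_eq_lintegral (f := g) (μ := μ) (p := 2) (by norm_num)
  have h := pow_le_pow_left' (T.le_opENorm (hf.toLp f)) 2
  rwa [mul_pow, Lp.enorm_def, Lp.enorm_toLp, key, key] at h

/-! ### Cotlar's inequality and the weak (2,2) bound. -/

section Truncation

variable {ε : ℝ} {K : ℂ → ℂ → ℂ} {μ : Measure ℂ} {f : ℂ → ℂ}

/-- Comparison of the truncations of a singular integral at two different scales. -/
theorem enorm_truncation_le_add (hε : 0 < ε) (hK : IsCalderonZygmundKernel ε K)
    (hf : Measurable f) (hfi : Integrable f μ) (x : ℂ) {r R : ℝ} (hr : 0 < r) (hrR : r ≤ R) :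
    ‖∫ y in (Metric.ball x r)ᶜ, K x y * f y ∂μ‖ₑ ≤
      ‖∫ y in (Metric.ball x (2 * R))ᶜ, K x y * f y ∂μ‖ₑ +
      (∫⁻ y in Metric.ball x R \ Metric.ball x r, ENNReal.ofReal (1 / ‖x - y‖)
        ∂(μ.withDensity fun y => ‖f y‖ₑ) +
      ENNReal.ofReal (1 / R) * (μ.withDensity fun y => ‖f y‖ₑ) (Metric.ball x (2 * R))) := by
  have hR : 0 < R := hr.trans_le hrR
  have hsub : Metric.ball x r ⊆ Metric.ball x (2 * R) := Metric.ball_subset_ball (by linarith)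
  have hset : (Metric.ball x r)ᶜ =
      (Metric.ball x (2 * R))ᶜ ∪ (Metric.ball x (2 * R) \ Metric.ball x r) := by
    ext y
    have := @hsub y
    simp only [mem_compl_iff, mem_union, mem_sdiff]
    tauto
  have hm := hK.integrableOn_mul hε x hr hfi
  have hgm : Measurable fun y : ℂ => ENNReal.ofReal (1 / ‖x - y‖) := by fun_prop
  rw [hset] at hm ⊢
  rw [setIntegral_union (disjoint_compl_left.mono_right sdiff_subset)
    (measurableSet_ball.diff measurableSet_ball) (hm.mono_set subset_union_left)
    (hm.mono_set subset_union_right)]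
  refine (enorm_add_le _ _).trans ?_
  gcongr
  calc _ ≤ ∫⁻ y in Metric.ball x (2 * R) \ Metric.ball x r, ‖K x y * f y‖ₑ ∂μ :=
        enorm_integral_le_lintegral_enorm _
    _ ≤ ∫⁻ y in Metric.ball x (2 * R) \ Metric.ball x r,
        ENNReal.ofReal (1 / ‖x - y‖) * ‖f y‖ₑ ∂μ := by
        refine setLIntegral_mono' (measurableSet_ball.diff measurableSet_ball) fun y hy => ?_
        rw [enorm_mul]
        gcongr
        refine hK.enorm_le ?_
        rintro rfl
        exact hy.2 (Metric.mem_ball_self hr)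
    _ = ∫⁻ y in Metric.ball x (2 * R) \ Metric.ball x r, ENNReal.ofReal (1 / ‖x - y‖)
        ∂(μ.withDensity fun y => ‖f y‖ₑ) :=
        setLIntegral_mul_enorm_eq hf hgm (measurableSet_ball.diff measurableSet_ball)
    _ ≤ ∫⁻ y in (Metric.ball x R \ Metric.ball x r) ∪ (Metric.ball x (2 * R) \ Metric.ball x R),
        ENNReal.ofReal (1 / ‖x - y‖) ∂(μ.withDensity fun y => ‖f y‖ₑ) := by
        refine lintegral_mono_set fun y hy => ?_
        by_cases h : y ∈ Metric.ball x R
        · exact Or.inl ⟨h, hy.2⟩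
        · exact Or.inr ⟨hy.1, h⟩
    _ ≤ _ := by
        refine (lintegral_union_le _ _ _).trans ?_
        gcongr
        calc _ ≤ ∫⁻ y in Metric.ball x (2 * R) \ Metric.ball x R,
              ENNReal.ofReal (1 / R) ∂(μ.withDensity fun y => ‖f y‖ₑ) := by
              refine setLIntegral_mono' (measurableSet_ball.diff measurableSet_ball) fun y hy => ?_
              have hy2 : R ≤ ‖x - y‖ := by
                simpa [dist_comm y x, dist_eq_norm] using hy.2
              gcongr
          _ ≤ _ := by
              rw [setLIntegral_const]
              gcongr
              exact sdiff_subset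

/-- The far part of a singular integral varies little over a ball. -/
theorem enorm_far_sub_le (hε : 0 < ε) (hK : IsCalderonZygmundKernel ε K)
    (hf : Measurable f) (hfi : Integrable f μ) {x z : ℂ} {R : ℝ} (hR : 0 < R)
    (hz : z ∈ Metric.ball x R) (Λ : ℝ≥0∞)
    (hΛ : ∀ r, 2 * R ≤ r →
      (μ.withDensity fun y => ‖f y‖ₑ) (Metric.ball x r) ≤ Λ * ENNReal.ofReal r) :
    ‖(∫ y in (Metric.ball x (2 * R))ᶜ, K x y * f y ∂μ) -
      ∫ y in (Metric.ball x (2 * R))ᶜ, K z y * f y ∂μ‖ₑ ≤ tailConst ε * Λ := by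
  have hzx : dist x z < R := by rw [dist_comm]; exact hz
  have hsub : (Metric.ball x (2 * R))ᶜ ⊆ (Metric.ball z R)ᶜ :=
    compl_subset_compl.2 (Metric.ball_subset_ball' (by rw [dist_comm]; linarith))
  have hgm : Measurable fun y : ℂ =>
      ENNReal.ofReal ((2 * R) ^ ε / ‖x - y‖ ^ (1 + ε)) := by fun_prop
  rw [← integral_sub (hK.integrableOn_mul hε x (by positivity) hfi)
    ((hK.integrableOn_mul hε z hR hfi).mono_set hsub)]
  calc _ ≤ ∫⁻ y in (Metric.ball x (2 * R))ᶜ, ‖K x y * f y - K z y * f y‖ₑ ∂μ :=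
        enorm_integral_le_lintegral_enorm _
    _ ≤ ∫⁻ y in (Metric.ball x (2 * R))ᶜ,
        ENNReal.ofReal ((2 * R) ^ ε / ‖x - y‖ ^ (1 + ε)) * ‖f y‖ₑ ∂μ := by
        refine setLIntegral_mono' measurableSet_ball.compl fun y hy => ?_
        rw [← sub_mul, enorm_mul]
        gcongr
        have hy2 : 2 * R ≤ ‖x - y‖ := by
          simpa [dist_comm y x, dist_eq_norm] using hy
        have hxz : ‖x - z‖ < R := by rwa [← dist_eq_norm]
        have hne : x ≠ y := by
          rintro rfl
          simp at hy2
          linarith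
        rw [← ofReal_norm]
        refine ENNReal.ofReal_le_ofReal ((hK.smooth_left x z y hne (by linarith)).trans ?_)
        gcongr
        linarith
    _ = _ := setLIntegral_mul_enorm_eq hf hgm measurableSet_ball.compl
    _ ≤ tailConst ε * Λ := lintegral_tail_le _ x hε (by positivity) Λ hΛ

end Truncation

/-- The constant of Cotlar's inequality. -/
noncomputable def cotlarConst (ε : ℝ) (N : ℝ≥0∞) : ℝ≥0∞ :=
  40 ^ 4 + 10 + 5 * tailConst ε + 40 + 40 * N

theorem integrable_of_memLp_two {μ : Measure ℂ} (hμ : AhlforsCondition μ) {f : ℂ → ℂ}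
    (hf2 : MemLp f 2 μ) {M : ℝ} (hM : ∀ y, y ∉ Metric.closedBall (0 : ℂ) M → f y = 0) :
    Integrable f μ := by
  have := hμ.isLocallyFiniteMeasure
  have : IsFiniteMeasure (μ.restrict (Metric.closedBall (0 : ℂ) M)) :=
    ⟨by simpa using (isCompact_closedBall (0 : ℂ) M).measure_lt_top⟩
  have h : IntegrableOn f (Metric.closedBall (0 : ℂ) M) μ :=
    hf2.restrict _ |>.integrable (by norm_num)
  refine (integrableOn_iff_integrable_of_support_subset fun y hy => ?_).1 h
  by_contra hc
  exact hy (hM y hc)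

/-- The form in which Cauchy–Schwarz is used: `b` is the mass of a ball, `a` an integral over it,
`c` the integral of the square. -/
theorem le_mul_of_sq_le_mul {a b c d : ℝ≥0∞} (h1 : a ^ 2 ≤ b * c) (h2 : c ≤ d ^ 2 * b) :
    a ≤ d * b := by
  have h : a ^ 2 ≤ (d * b) ^ 2 :=
    calc a ^ 2 ≤ b * (d ^ 2 * b) := h1.trans (by gcongr)
      _ = (d * b) ^ 2 := by ring
  exact (ENNReal.pow_le_pow_left_iff (by norm_num)).1 h

/-- **Cotlar's inequality** at a point where `|f|²` and `|Tf|²` are dominated by `μ`. -/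
theorem enorm_truncation_le_of_dominated {ε : ℝ} (hε : 0 < ε) {μ : Measure ℂ}
    (hμ : AhlforsCondition μ)
    {K : ℂ → ℂ → ℂ} (hK : IsCalderonZygmundKernel ε K) {T : Lp ℂ 2 μ →L[ℂ] Lp ℂ 2 μ}
    (hT : HasKernel μ K T) {f : ℂ → ℂ} (hf : Measurable f) (hf2 : MemLp f 2 μ) {M : ℝ}
    (hM : ∀ y, y ∉ Metric.closedBall (0 : ℂ) M → f y = 0) {x : ℂ} (l : ℝ≥0∞)
    (h0 : ∀ r : ℝ, 0 < r → μ (Metric.ball x r) ≠ 0)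
    (h1 : ∀ r : ℝ, 0 < r →
      ∫⁻ y in Metric.ball x r, ‖f y‖ₑ ^ 2 ∂μ ≤ l ^ 2 * μ (Metric.ball x (5 * r)))
    (h2 : ∀ r : ℝ, 0 < r →
      ∫⁻ y in Metric.ball x r, ‖T (hf2.toLp f) y‖ₑ ^ 2 ∂μ ≤ l ^ 2 * μ (Metric.ball x (5 * r)))
    {r : ℝ} (hr : 0 < r) :
    ‖∫ y in (Metric.ball x r)ᶜ, K x y * f y ∂μ‖ₑ ≤ cotlarConst ε ‖T‖ₑ * l := by
  have hfi := integrable_of_memLp_two hμ hf2 hM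
  set σ : Measure ℂ := μ.withDensity fun y => ‖f y‖ₑ with hσ
  -- Cauchy–Schwarz turns the quadratic domination `h1` into a linear one; the mass of the ball
  -- itself is enlarged to that of the five-fold ball.
  have hσl : ∀ s : ℝ, 0 < s → σ (Metric.ball x s) ≤ l * μ (Metric.ball x (5 * s)) := by
    intro s hs
    rw [hσ, withDensity_apply _ measurableSet_ball]
    refine le_mul_of_sq_le_mul (c := ∫⁻ y in Metric.ball x s, ‖f y‖ₑ ^ 2 ∂μ) ?_ (h1 s hs)
    refine (sq_lintegral_le _ hf.enorm.aemeasurable).trans ?_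
    rw [Measure.restrict_apply_univ]
    gcongr
    linarith
  obtain ⟨R, hrR, hdbl, hgap⟩ := exists_doubling_radius hμ x hr (h0 r hr)
  have hR : 0 < R := hr.trans_le hrR
  set B := Metric.ball x R with hB
  have hB0 : μ B ≠ 0 := h0 R hR
  have hB1 : μ B ≠ ∞ := hμ.measure_ball_ne_top x R
  have hgrow : ∀ s : ℝ, 2 * R ≤ s → σ (Metric.ball x s) ≤ 5 * l * ENNReal.ofReal s := by
    intro s hs
    have hs0 : 0 < s := by linarith
    calc σ (Metric.ball x s) ≤ l * μ (Metric.ball x (5 * s)) := hσl s hs0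
      _ ≤ l * ENNReal.ofReal (5 * s) := by gcongr; exact hμ _ _ (by positivity)
      _ = 5 * l * ENNReal.ofReal s := by
        rw [ENNReal.ofReal_mul (by norm_num)]
        norm_num
        ring
  have hnear := enorm_truncation_le_add hε hK hf hfi x hr hrR
  have hgap' := hgap σ l fun s hs => (hσl s (hr.trans_le hs)).trans 
    (mul_le_mul' le_rfl (measure_mono (Metric.ball_subset_ball (by linarith))))
  have hmid : ENNReal.ofReal (1 / R) * σ (Metric.ball x (2 * R)) ≤ 10 * l := by
    calc _ ≤ ENNReal.ofReal (1 / R) * (5 * l * ENNReal.ofReal (2 * R)) := by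
          gcongr
          exact hgrow _ le_rfl
      _ = 5 * l * ENNReal.ofReal (1 / R * (2 * R)) := by
          rw [ENNReal.ofReal_mul (p := 1 / R) (by positivity)]
          ring
      _ = 10 * l := by
          rw [show 1 / R * (2 * R) = 2 by field_simp]
          norm_num
          ring
  set c : ℝ≥0∞ := ‖∫ y in (Metric.ball x (2 * R))ᶜ, K x y * f y ∂μ‖ₑ with hc
  set f₁ : ℂ → ℂ := (Metric.ball x (2 * R)).indicator f with hf₁
  set f₂ : ℂ → ℂ := (Metric.ball x (2 * R))ᶜ.indicator f with hf₂
  have hf₁m : MemLp f₁ 2 μ := hf2.indicator measurableSet_ball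
  have hf₂m : MemLp f₂ 2 μ := hf2.indicator measurableSet_ball.compl
  have hsum : hf2.toLp f = hf₁m.toLp f₁ + hf₂m.toLp f₂ := by
    rw [← MemLp.toLp_add]
    congr 1
    exact (indicator_self_add_compl _ _).symm
  have hTsum : ∀ᵐ z ∂μ, T (hf2.toLp f) z = T (hf₁m.toLp f₁) z + T (hf₂m.toLp f₂) z := by
    rw [hsum, map_add]
    exact Lp.coeFn_add _ _
  -- `HasKernel` gives the formula only off a compact set carrying the function. Here that set is
  -- the part of the disk of radius `M` outside `B(x, 2R)`, which is disjoint from `B`.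
  have hker : ∀ᵐ z ∂μ, z ∈ B →
      T (hf₂m.toLp f₂) z = ∫ y in (Metric.ball x (2 * R))ᶜ, K z y * f y ∂μ := by
    have h := hT (hf₂m.toLp f₂) (Metric.closedBall 0 M ∩ (Metric.ball x (2 * R))ᶜ)
      ((isCompact_closedBall 0 M).inter_right Metric.isOpen_ball.isClosed_compl) (by
        filter_upwards [hf₂m.coeFn_toLp] with y hy hyS
        rw [hy, hf₂]
        by_cases hyb : y ∈ (Metric.ball x (2 * R))ᶜ
        · rw [indicator_of_mem hyb]
          exact hM y fun hyM => hyS ⟨hyM, hyb⟩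
        · exact indicator_of_notMem hyb _)
    filter_upwards [h] with z hz hzB
    have hzS : z ∉ Metric.closedBall 0 M ∩ (Metric.ball x (2 * R))ᶜ :=
      fun hz => hz.2 (Metric.ball_subset_ball (by linarith) hzB)
    rw [hz hzS, ← integral_indicator measurableSet_ball.compl]
    refine integral_congr_ae ?_
    filter_upwards [hf₂m.coeFn_toLp] with y hy
    rw [hy, hf₂]
    by_cases hyb : y ∈ (Metric.ball x (2 * R))ᶜ
    · simp only [indicator_of_mem hyb]
    · simp only [indicator_of_notMem hyb, mul_zero]
  have hpt : ∀ᵐ z ∂μ, z ∈ B → c ≤ tailConst ε * (5 * l) +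
      (‖T (hf2.toLp f) z‖ₑ + ‖T (hf₁m.toLp f₁) z‖ₑ) := by
    filter_upwards [hTsum, hker] with z hz1 hz2 hzB
    have hfar := enorm_far_sub_le hε hK hf hfi hR hzB (5 * l) hgrow
    rw [← hz2 hzB] at hfar
    have heq : T (hf₂m.toLp f₂) z = T (hf2.toLp f) z - T (hf₁m.toLp f₁) z := by
      rw [hz1]; ring
    calc c = ‖((∫ y in (Metric.ball x (2 * R))ᶜ, K x y * f y ∂μ) - T (hf₂m.toLp f₂) z) +
          T (hf₂m.toLp f₂) z‖ₑ := by rw [sub_add_cancel]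
      _ ≤ _ := (enorm_add_le _ _).trans (by
          gcongr
          rw [heq]
          exact enorm_sub_le)
  -- The factor 40 is the square root of the doubling constant 1600.
  have hT1 : ∫⁻ z in B, ‖T (hf2.toLp f) z‖ₑ ∂μ ≤ 40 * l * μ B := by
    refine le_mul_of_sq_le_mul (c := ∫⁻ z in B, ‖T (hf2.toLp f) z‖ₑ ^ 2 ∂μ) ?_ ?_
    · refine (sq_lintegral_le _ (Lp.stronglyMeasurable _).measurable.enorm.aemeasurable).trans ?_
      rw [Measure.restrict_apply_univ]
    · calc _ ≤ l ^ 2 * μ (Metric.ball x (5 * R)) := h2 R hR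
        _ ≤ l ^ 2 * (1600 * μ B) := by
          gcongr
          exact (measure_mono (Metric.ball_subset_ball (by linarith))).trans hdbl
        _ = (40 * l) ^ 2 * μ B := by ring
  have hT2 : ∫⁻ z in B, ‖T (hf₁m.toLp f₁) z‖ₑ ∂μ ≤ 40 * ‖T‖ₑ * l * μ B := by
    refine le_mul_of_sq_le_mul (c := ∫⁻ z in B, ‖T (hf₁m.toLp f₁) z‖ₑ ^ 2 ∂μ) ?_ ?_
    · refine (sq_lintegral_le _ (Lp.stronglyMeasurable _).measurable.enorm.aemeasurable).trans ?_
      rw [Measure.restrict_apply_univ]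
    · calc _ ≤ ∫⁻ z, ‖T (hf₁m.toLp f₁) z‖ₑ ^ 2 ∂μ := setLIntegral_le_lintegral _ _
        _ ≤ ‖T‖ₑ ^ 2 * ∫⁻ z, ‖f₁ z‖ₑ ^ 2 ∂μ := lintegral_enorm_sq_apply_le T hf₁m
        _ = ‖T‖ₑ ^ 2 * ∫⁻ z in Metric.ball x (2 * R), ‖f z‖ₑ ^ 2 ∂μ := by
          rw [← lintegral_indicator measurableSet_ball]
          congr 2
          ext z
          by_cases hz : z ∈ Metric.ball x (2 * R)
          · simp only [hf₁, indicator_of_mem hz]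
          · simp [hf₁, indicator_of_notMem hz]
        _ ≤ ‖T‖ₑ ^ 2 * (l ^ 2 * μ (Metric.ball x (5 * (2 * R)))) := by
          gcongr
          exact h1 _ (by positivity)
        _ ≤ ‖T‖ₑ ^ 2 * (l ^ 2 * (1600 * μ B)) := by
          gcongr
          exact (measure_mono (Metric.ball_subset_ball (by linarith))).trans hdbl
        _ = (40 * ‖T‖ₑ * l) ^ 2 * μ B := by ring
  have hcB : c ≤ 5 * tailConst ε * l + 40 * l + 40 * ‖T‖ₑ * l := by
    rw [← ENNReal.mul_le_mul_iff_left hB0 hB1]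
    calc c * μ B = ∫⁻ _ in B, c ∂μ := (setLIntegral_const _ _).symm
      _ ≤ ∫⁻ z in B, (tailConst ε * (5 * l) +
          (‖T (hf2.toLp f) z‖ₑ + ‖T (hf₁m.toLp f₁) z‖ₑ)) ∂μ :=
          setLIntegral_mono_ae' measurableSet_ball hpt
      _ = tailConst ε * (5 * l) * μ B + (∫⁻ z in B, ‖T (hf2.toLp f) z‖ₑ ∂μ +
          ∫⁻ z in B, ‖T (hf₁m.toLp f₁) z‖ₑ ∂μ) := by
          rw [lintegral_add_left measurable_const, setLIntegral_const, lintegral_add_left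
            (Lp.stronglyMeasurable _).measurable.enorm]
      _ ≤ tailConst ε * (5 * l) * μ B + (40 * l * μ B + 40 * ‖T‖ₑ * l * μ B) := by gcongr
      _ = _ := by ring
  calc _ ≤ c + (40 ^ 4 * l + 10 * l) := hnear.trans (by gcongr)
    _ ≤ 5 * tailConst ε * l + 40 * l + 40 * ‖T‖ₑ * l + (40 ^ 4 * l + 10 * l) := by gcongr
    _ = cotlarConst ε ‖T‖ₑ * l := by rw [cotlarConst]; ring

/-- The maximal truncation of a bounded singular integral operator is of weak type `(2, 2)`. -/
theorem truncation_weak_type_two {ε : ℝ} (hε : 0 < ε) {μ : Measure ℂ}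
    (hμ : AhlforsCondition μ)
    {K : ℂ → ℂ → ℂ} (hK : IsCalderonZygmundKernel ε K) {T : Lp ℂ 2 μ →L[ℂ] Lp ℂ 2 μ}
    (hT : HasKernel μ K T) {f : ℂ → ℂ} (hf : Measurable f) (hf2 : MemLp f 2 μ) {M : ℝ}
    (hM : ∀ y, y ∉ Metric.closedBall (0 : ℂ) M → f y = 0) (l : ℝ≥0∞) :
    l ^ 2 * μ {x | l < ⨆ (r : ℝ) (_ : 0 < r), ‖∫ y in (Metric.ball x r)ᶜ, K x y * f y ∂μ‖ₑ} ≤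
      cotlarConst ε ‖T‖ₑ ^ 2 * (1 + ‖T‖ₑ ^ 2) * ∫⁻ x, ‖f x‖ₑ ^ 2 ∂μ := by
  have hC0 : cotlarConst ε ‖T‖ₑ ≠ 0 := by simp [cotlarConst]
  have hC1 : cotlarConst ε ‖T‖ₑ ≠ ∞ := by
    have := tailConst_ne_top hε
    rw [cotlarConst]
    finiteness
  set C := cotlarConst ε ‖T‖ₑ
  -- Cotlar's inequality bounds the maximal truncation by `C * k = l` off the exceptional sets,
  -- which are maximal-function level sets at height `k ^ 2`.
  obtain ⟨k, hk⟩ : ∃ k, l = C * k := ⟨l / C, (ENNReal.mul_div_cancel hC0 hC1).symm⟩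
  have hsub : {x | l < ⨆ (r : ℝ) (_ : 0 < r), ‖∫ y in (Metric.ball x r)ᶜ, K x y * f y ∂μ‖ₑ} ⊆
      {x | ¬ ∀ r : ℝ, 0 < r → μ (Metric.ball x r) ≠ 0} ∪
      ({x | ∃ r : ℝ, 0 < r ∧ k ^ 2 * μ (Metric.ball x (5 * r)) <
        (μ.withDensity fun y => ‖f y‖ₑ ^ 2) (Metric.ball x r)} ∪
      {x | ∃ r : ℝ, 0 < r ∧ k ^ 2 * μ (Metric.ball x (5 * r)) <
        (μ.withDensity fun y => ‖T (hf2.toLp f) y‖ₑ ^ 2) (Metric.ball x r)}) := by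
    intro x hx
    by_contra hcon
    simp only [mem_union, mem_ofPred_eq, not_or, not_not, not_exists, not_and, not_lt] at hcon
    obtain ⟨h0, h1, h2⟩ := hcon
    simp only [withDensity_apply _ measurableSet_ball] at h1 h2
    refine absurd (iSup₂_le fun r hr => ?_) (not_le.2 (mem_ofPred_eq ▸ hx))
    rw [hk]
    exact enorm_truncation_le_of_dominated hε hμ hK hT hf hf2 hM k h0 h1 h2 hr
  have hnull : μ {x | ¬ ∀ r : ℝ, 0 < r → μ (Metric.ball x r) ≠ 0} = 0 :=
    ae_iff.1 (ae_measure_ball_ne_zero μ)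
  calc _ ≤ l ^ 2 * (0 + (μ {x | ∃ r : ℝ, 0 < r ∧ k ^ 2 * μ (Metric.ball x (5 * r)) <
        (μ.withDensity fun y => ‖f y‖ₑ ^ 2) (Metric.ball x r)} +
        μ {x | ∃ r : ℝ, 0 < r ∧ k ^ 2 * μ (Metric.ball x (5 * r)) <
        (μ.withDensity fun y => ‖T (hf2.toLp f) y‖ₑ ^ 2) (Metric.ball x r)})) := by
        gcongr
        refine (measure_mono hsub).trans ((measure_union_le _ _).trans ?_)
        rw [hnull]
        gcongr
        exact measure_union_le _ _
    _ = C ^ 2 * (k ^ 2 * μ {x | ∃ r : ℝ, 0 < r ∧ k ^ 2 * μ (Metric.ball x (5 * r)) <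
        (μ.withDensity fun y => ‖f y‖ₑ ^ 2) (Metric.ball x r)} +
        k ^ 2 * μ {x | ∃ r : ℝ, 0 < r ∧ k ^ 2 * μ (Metric.ball x (5 * r)) <
        (μ.withDensity fun y => ‖T (hf2.toLp f) y‖ₑ ^ 2) (Metric.ball x r)}) := by
        rw [hk]; ring
    _ ≤ C ^ 2 * (∫⁻ x, ‖f x‖ₑ ^ 2 ∂μ + ‖T‖ₑ ^ 2 * ∫⁻ x, ‖f x‖ₑ ^ 2 ∂μ) := by
        refine mul_le_mul' le_rfl (add_le_add ?_ ?_)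
        · refine (maximal_weak_type _ _ _).trans (le_of_eq ?_)
          rw [withDensity_apply _ MeasurableSet.univ, setLIntegral_univ]
        · refine (maximal_weak_type _ _ _).trans ?_
          rw [withDensity_apply _ MeasurableSet.univ, setLIntegral_univ]
          exact lintegral_enorm_sq_apply_le T hf2
    _ = _ := by ring

/-! ### Spreading atoms over doubling balls. -/

/-- Spreading point masses over balls of increasing radii with bounded total density. -/
theorem exists_bounded_overlap_sets {μ : Measure ℂ} (hμ : ∀ x r, μ (Metric.ball x r) ≠ ∞)
    (R : ℂ → ℝ) (α : ℂ → ℝ≥0∞) {L : ℝ≥0∞} (hL0 : L ≠ 0) (hL1 : L ≠ ∞) (s : Finset ℂ)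
    (h0 : ∀ p ∈ s, μ (Metric.ball p (R p)) ≠ 0)
    (hL : ∀ p ∈ s, ∑ q ∈ s, (Metric.ball p (2 * R p)).indicator (fun _ => α q) q ≤
      L * μ (Metric.ball p (R p))) :
    ∃ A : ℂ → Set ℂ, (∀ p ∈ s, MeasurableSet (A p) ∧ A p ⊆ Metric.ball p (R p) ∧
      μ (Metric.ball p (R p)) ≤ 2 * μ (A p)) ∧
      ∀ y, ∑ p ∈ s, (A p).indicator (fun _ => α p / μ (A p)) y ≤ 4 * L := by
  -- The ball of largest radius comes last: every earlier set meeting it then has its center in the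
  -- doubled ball, where `hL` bounds the total mass.
  induction s using Finset.induction_on_max_value R with
  | empty => exact ⟨fun _ => ∅, by simp⟩
  | insert a s has hmax ih =>
    obtain ⟨A, hA, hsum⟩ := ih (fun p hp => h0 p (Finset.mem_insert_of_mem hp)) fun p hp =>
      (Finset.sum_le_sum_of_subset (Finset.subset_insert a s)).trans
        (hL p (Finset.mem_insert_of_mem hp))
    set B := Metric.ball a (R a) with hB
    have hB0 : μ B ≠ 0 := h0 a (Finset.mem_insert_self a s)
    have hB1 : μ B ≠ ∞ := hμ _ _
    have hRa : 0 < R a := by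
      by_contra! h
      exact hB0 (by simp [hB, Metric.ball_eq_empty.2 h])
    have hLa := hL a (Finset.mem_insert_self a s)
    rw [Finset.sum_insert has,
      indicator_of_mem (Metric.mem_ball_self (by positivity : 0 < 2 * R a))] at hLa
    set φ : ℂ → ℝ≥0∞ := fun y => ∑ p ∈ s, (A p).indicator (fun _ => α p / μ (A p)) y with hφ
    have hφm : Measurable φ :=
      Finset.measurable_fun_sum _ fun p hp => measurable_const.indicator (hA p hp).1
    have hint : ∫⁻ y in B, φ y ∂μ ≤ L * μ B := by
      rw [hφ, lintegral_finsetSum' _ fun p hp =>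
        (measurable_const.indicator (hA p hp).1).aemeasurable]
      refine le_trans (Finset.sum_le_sum fun p hp => ?_) ((le_add_left le_rfl).trans hLa)
      by_cases hpa : p ∈ Metric.ball a (2 * R a)
      · rw [indicator_of_mem hpa]
        refine (setLIntegral_le_lintegral _ _).trans ?_
        rw [lintegral_indicator_const (hA p hp).1]
        rw [mul_comm]
        exact ENNReal.mul_div_le
      · rw [indicator_of_notMem hpa, nonpos_iff_eq_zero, ← lintegral_zero (μ := μ.restrict B)]
        refine setLIntegral_congr_fun measurableSet_ball fun y hy => ?_
        refine indicator_of_notMem (fun hyA => hpa ?_) _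
        have h1 : dist y p < R p := (hA p hp).2.1 hyA
        have h2 : dist y a < R a := hy
        have h3 := hmax p hp
        have h4 := dist_triangle_left p a y
        rw [Metric.mem_ball]
        linarith
    -- By Chebyshev, density above `2 * L` occupies at most half of `B`. Spreading `α a` over the
    -- other half adds at most another `2 * L` there.
    have hbad : 2 * μ (B ∩ {y | 2 * L < φ y}) ≤ μ B := by
      rw [← ENNReal.mul_le_mul_iff_right hL0 hL1]
      calc L * (2 * μ (B ∩ {y | 2 * L < φ y})) =
            2 * L * μ (B ∩ {y | 2 * L < φ y}) := by ring
        _ = ∫⁻ _ in B ∩ {y | 2 * L < φ y}, 2 * L ∂μ := (setLIntegral_const _ _).symm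
        _ ≤ ∫⁻ y in B ∩ {y | 2 * L < φ y}, φ y ∂μ :=
          setLIntegral_mono' (measurableSet_ball.inter (measurableSet_lt measurable_const hφm))
            fun y hy => (show 2 * L < φ y from hy.2).le
        _ ≤ ∫⁻ y in B, φ y ∂μ := lintegral_mono_set inter_subset_left
        _ ≤ L * μ B := hint
    set A' : Set ℂ := B ∩ {y | φ y ≤ 2 * L} with hA'
    have hA'm : MeasurableSet A' := measurableSet_ball.inter (measurableSet_le hφm measurable_const)
    have hhalf : μ B ≤ 2 * μ A' := by
      have h1 : μ B ≤ μ A' + μ (B ∩ {y | 2 * L < φ y}) := by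
        refine (measure_mono fun y hy => ?_).trans (measure_union_le _ _)
        rcases le_or_gt (φ y) (2 * L) with h | h
        · exact Or.inl ⟨hy, h⟩
        · exact Or.inr ⟨hy, h⟩
      have h2 : μ B + μ B ≤ 2 * μ A' + μ B :=
        calc μ B + μ B = 2 * μ B := (two_mul _).symm
          _ ≤ 2 * (μ A' + μ (B ∩ {y | 2 * L < φ y})) := by gcongr
          _ = 2 * μ A' + 2 * μ (B ∩ {y | 2 * L < φ y}) := by ring
          _ ≤ 2 * μ A' + μ B := by gcongr
      exact (ENNReal.add_le_add_iff_right hB1).1 h2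
    have hA'0 : μ A' ≠ 0 := by
      intro h
      rw [h, mul_zero] at hhalf
      exact hB0 (nonpos_iff_eq_zero.1 hhalf)
    have hA'1 : μ A' ≠ ∞ := ne_top_of_le_ne_top hB1 (measure_mono inter_subset_left)
    have hne : ∀ p ∈ s, p ≠ a := fun p hp h => has (h ▸ hp)
    refine ⟨Function.update A a A', fun p hp => ?_, fun y => ?_⟩
    · rcases Finset.mem_insert.1 hp with rfl | hp
      · rw [Function.update_self]
        exact ⟨hA'm, inter_subset_left, hhalf⟩
      · rw [Function.update_of_ne (hne p hp)]
        exact hA p hp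
    · have hold : ∑ p ∈ s, (Function.update A a A' p).indicator
          (fun _ => α p / μ (Function.update A a A' p)) y = φ y :=
        Finset.sum_congr rfl fun p hp => by rw [Function.update_of_ne (hne p hp)]
      rw [Finset.sum_insert has, hold, Function.update_self]
      by_cases hy : y ∈ A'
      · rw [indicator_of_mem hy]
        have h1 : α a / μ A' ≤ 2 * L := by
          rw [ENNReal.div_le_iff hA'0 hA'1]
          calc α a ≤ L * μ B := (le_add_right le_rfl).trans hLa
            _ ≤ L * (2 * μ A') := by gcongr
            _ = 2 * L * μ A' := by ring
        calc _ ≤ 2 * L + 2 * L := add_le_add h1 hy.2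
          _ = 4 * L := by ring
      · rw [indicator_of_notMem hy, zero_add]
        exact hsum y

theorem lintegral_annulus_le {μ : Measure ℂ} (hμ : AhlforsCondition μ) (p : ℂ) {a b : ℝ}
    (ha : 0 < a) (hb : 0 < b) :
    ∫⁻ y in Metric.ball p b \ Metric.ball p a, ENNReal.ofReal (1 / ‖p - y‖) ∂μ ≤
      ENNReal.ofReal (b / a) := by
  calc _ ≤ ∫⁻ y in Metric.ball p b \ Metric.ball p a, ENNReal.ofReal (1 / a) ∂μ := by
        refine setLIntegral_mono' (measurableSet_ball.diff measurableSet_ball) fun y hy => ?_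
        have hy2 : a ≤ ‖p - y‖ := by
          simpa [dist_comm y p, dist_eq_norm] using hy.2
        gcongr
    _ ≤ ENNReal.ofReal (1 / a) * ENNReal.ofReal b := by
        rw [setLIntegral_const]
        gcongr
        exact (measure_mono sdiff_subset).trans (hμ p b hb)
    _ = ENNReal.ofReal (b / a) := by
        rw [← ENNReal.ofReal_mul (by positivity)]
        congr 1
        ring

/-- Stopping radii at an atom `p` of `ν`: the ball of radius `ρ` misses the set where `ν` is
dominated by `μ`, and the doubling ball of radius `R` has a controlled `ν`-density. -/
theorem exists_stopping_radii {μ ν : Measure ℂ} (hμ : AhlforsCondition μ) {l : ℝ≥0∞}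
    (hl1 : l ≠ ∞) {G : Set ℂ} (hG : G.Nonempty)
    (hGd : ∀ z ∈ G, ∀ r : ℝ, 0 < r → ν (Metric.ball z r) ≤ l * μ (Metric.ball z (5 * r)))
    {p : ℂ} (hp : ν {p} ≠ 0) :
    ∃ ρ R : ℝ, 0 < ρ ∧ 0 < R ∧ (∀ x ∈ G, x ∉ Metric.ball p ρ) ∧ μ (Metric.ball p R) ≠ 0 ∧
      μ (Metric.ball p (2 * R)) ≤ 1600 * μ (Metric.ball p R) ∧
      ν (Metric.ball p (2 * R)) ≤ 1600 * l * μ (Metric.ball p R) ∧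
      ∫⁻ x in Metric.ball p (2 * R) \ Metric.ball p ρ, ENNReal.ofReal (1 / ‖p - x‖) ∂μ ≤
        40 ^ 4 + 42 := by
  have hatom : ∀ z r, p ∈ Metric.ball z r → ν {p} ≤ ν (Metric.ball z r) := fun z r h =>
    measure_mono (singleton_subset_iff.2 h)
  -- Good points near `p` would force `ν {p} ≤ 5 l r` for every small `r`, although `p` is an atom.
  have hρ : 0 < Metric.infDist p G := by
    refine lt_of_le_of_ne Metric.infDist_nonneg fun h => ?_
    have hlim : Filter.Tendsto (fun r : ℝ => l * ENNReal.ofReal (5 * r))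
        (nhdsWithin 0 (Ioi 0)) (nhds (l * ENNReal.ofReal (5 * 0))) := by
      refine ENNReal.Tendsto.const_mul (Filter.Tendsto.mono_left ?_ nhdsWithin_le_nhds)
        (Or.inr hl1)
      exact (ENNReal.continuous_ofReal.comp (continuous_const.mul continuous_id)).tendsto 0
    simp only [mul_zero, ENNReal.ofReal_zero] at hlim
    refine hp (nonpos_iff_eq_zero.1 (ge_of_tendsto hlim ?_))
    filter_upwards [self_mem_nhdsWithin] with r (hr : 0 < r)
    obtain ⟨z, hz, hzr⟩ := (Metric.infDist_lt_iff hG).1 (h ▸ hr)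
    exact (hatom z r hzr).trans ((hGd z hz r hr).trans (by gcongr; exact hμ _ _ (by positivity)))
  set ρ := Metric.infDist p G with hρdef
  obtain ⟨z, hz, hzr⟩ := (Metric.infDist_lt_iff hG).1 (show Metric.infDist p G < 2 * ρ by linarith)
  -- As `z` lies within `2 * ρ ≤ 2 * r` of `p`, the radius grows as `r → 3r → 15r → 17r`. Since `17
  -- * 2 ≤ 40`, a doubling radius absorbs this even for the doubled ball.
  have hdom : ∀ r, ρ ≤ r → ν (Metric.ball p r) ≤ l * μ (Metric.ball p (17 * r)) := by
    intro r hr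
    calc ν (Metric.ball p r) ≤ ν (Metric.ball z (3 * r)) :=
          measure_mono (Metric.ball_subset_ball' (by linarith))
      _ ≤ l * μ (Metric.ball z (5 * (3 * r))) := hGd z hz _ (by linarith)
      _ ≤ l * μ (Metric.ball p (17 * r)) := by
          gcongr
          exact Metric.ball_subset_ball' (by rw [dist_comm]; linarith)
  -- The search for a doubling scale starts at `40 * ρ`, since `B(p, ρ)` may be `μ`-null whereas the
  -- domination at scale `ρ` charges `B(p, 17ρ)`.
  have hpos : μ (Metric.ball p (40 * ρ)) ≠ 0 := by
    intro h
    have h1 : μ (Metric.ball p (17 * ρ)) = 0 :=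
      measure_mono_null (Metric.ball_subset_ball (by linarith)) h
    have h2 := (hatom p ρ (Metric.mem_ball_self hρ)).trans (hdom ρ le_rfl)
    rw [h1, mul_zero] at h2
    exact hp (nonpos_iff_eq_zero.1 h2)
  obtain ⟨R, hR, hdbl, hgap⟩ := exists_doubling_radius hμ p (by positivity) hpos
  have hR0 : 0 < R := by linarith
  have hgap' := hgap μ 1 fun r hr => by
    rw [one_mul]
    exact measure_mono (Metric.ball_subset_ball (by linarith))
  refine ⟨ρ, R, hρ, hR0, fun x hx hxp => ?_, ?_, ?_, ?_, ?_⟩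
  · have h1 := Metric.infDist_le_dist_of_mem (x := p) hx
    rw [Metric.mem_ball, dist_comm] at hxp
    linarith
  · intro h
    exact hpos (measure_mono_null (Metric.ball_subset_ball hR) h)
  · exact (measure_mono (Metric.ball_subset_ball (by linarith))).trans hdbl
  · calc ν (Metric.ball p (2 * R)) ≤ l * μ (Metric.ball p (17 * (2 * R))) :=
          hdom _ (by linarith)
      _ ≤ l * (1600 * μ (Metric.ball p R)) := by
          gcongr
          exact (measure_mono (Metric.ball_subset_ball (by linarith))).trans hdbl
      _ = 1600 * l * μ (Metric.ball p R) := by ring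
  · calc _ ≤ ∫⁻ x in (Metric.ball p R \ Metric.ball p (40 * ρ)) ∪
          ((Metric.ball p (2 * R) \ Metric.ball p R) ∪
            (Metric.ball p (40 * ρ) \ Metric.ball p ρ)), ENNReal.ofReal (1 / ‖p - x‖) ∂μ := by
          refine lintegral_mono_set fun x hx => ?_
          by_cases h1 : x ∈ Metric.ball p (40 * ρ)
          · exact Or.inr (Or.inr ⟨h1, hx.2⟩)
          · by_cases h2 : x ∈ Metric.ball p R
            · exact Or.inl ⟨h2, h1⟩
            · exact Or.inr (Or.inl ⟨hx.1, h2⟩)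
      _ ≤ 40 ^ 4 * 1 + (ENNReal.ofReal (2 * R / R) + ENNReal.ofReal (40 * ρ / ρ)) := by
          refine (lintegral_union_le _ _ _).trans (add_le_add hgap' ?_)
          exact (lintegral_union_le _ _ _).trans (add_le_add
            (lintegral_annulus_le hμ p hR0 (by positivity))
            (lintegral_annulus_le hμ p hρ (by positivity)))
      _ = 40 ^ 4 + 42 := by
          rw [mul_div_cancel_right₀ _ hR0.ne', mul_div_cancel_right₀ _ hρ.ne']
          norm_num

/-- Off the double of a ball, replacing a point mass by its spread-out version changes the
truncated singular integrals little. -/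
theorem enorm_atom_sub_spread_le {ε : ℝ} (hε : 0 < ε) {K : ℂ → ℂ → ℂ}
    (hK : IsCalderonZygmundKernel ε K) {μ : Measure ℂ} {p x : ℂ} {R r : ℝ} (hR : 0 < R)
    (hr : 0 < r) {A : Set ℂ} (hA : MeasurableSet A) (hAR : A ⊆ Metric.ball p R)
    (hA1 : μ A ≠ ∞) {α c : ℝ≥0} (hc : (c : ℝ≥0∞) * μ A = α)
    (hx : x ∉ Metric.ball p (2 * R)) :
    ‖(Metric.ball x r)ᶜ.indicator (fun y => (α : ℂ) * K x y) p -
      ∫ y in (Metric.ball x r)ᶜ, K x y * A.indicator (fun _ => (c : ℂ)) y ∂μ‖ₑ ≤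
      α * ENNReal.ofReal ((2 * R) ^ ε / ‖p - x‖ ^ (1 + ε)) +
      (Metric.ball x (3 * r)).indicator (fun _ => (α : ℝ≥0∞) * (2 * ENNReal.ofReal (1 / r))) p := by
  have hxp : 2 * R ≤ ‖p - x‖ := by
    simpa [dist_eq_norm, norm_sub_rev] using hx
  have hαe : ∀ z : ℂ, ‖(α : ℂ) * z‖ₑ = α * ‖z‖ₑ := fun z => by
    rw [enorm_mul]
    congr 1
    simp [enorm_eq_nnnorm]
  have hfin : IsFiniteMeasure (μ.restrict A) := ⟨by simpa using hA1.lt_top⟩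
  have hprod : ∀ y, K x y * A.indicator (fun _ => (c : ℂ)) y =
      A.indicator (fun y => K x y * (c : ℂ)) y := fun y => by
    by_cases hy : y ∈ A <;> simp [hy]
  -- Either `p` and `A` both lie outside `B(x, r)` and smoothness applies to equal masses, or `‖p -
  -- x‖ < r + R` with `2 * R ≤ ‖p - x‖`. The latter gives `‖p - x‖ < 2 * r`, and the size bound `1 /
  -- r` suffices for both terms.
  rcases le_or_gt r (‖p - x‖ - R) with hcase | hcase
  · have hAc : A ⊆ (Metric.ball x r)ᶜ := by
      intro y hy hyx
      have h1 : dist y p < R := hAR hy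
      have h2 : dist y x < r := hyx
      have h3 := dist_triangle_left p x y
      rw [dist_eq_norm p x] at h3
      linarith
    have hpc : p ∈ (Metric.ball x r)ᶜ := by
      rw [mem_compl_iff, Metric.mem_ball, dist_eq_norm]
      linarith
    refine le_add_right ?_
    rw [indicator_of_mem hpc]
    simp only [hprod]
    rw [setIntegral_indicator hA, inter_eq_right.2 hAc]
    have hconst : (α : ℂ) * K x p = ∫ _ in A, K x p * (c : ℂ) ∂μ := by
      rw [setIntegral_const, measureReal_def]
      have : (μ A).toReal * c = α := by
        have := congrArg ENNReal.toReal hc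
        rw [ENNReal.toReal_mul] at this
        simpa [mul_comm] using this
      have hC : (α : ℂ) = (((μ A).toReal * c : ℝ) : ℂ) := by rw [this]
      rw [Complex.real_smul, hC]
      push_cast
      ring
    have hKA : IntegrableOn (fun y => K x y * (c : ℂ)) A μ := by
      refine Integrable.mul_const (Integrable.of_bound
        ((hK.aestronglyMeasurable hε x hr μ).mono_measure
          (Measure.restrict_mono hAc le_rfl)) (1 / r) ?_) _
      filter_upwards [ae_restrict_mem hA] with y hy
      exact hK.norm_le_of_notMem_ball hr (hAc hy)
    rw [hconst, ← integral_sub (integrable_const _) hKA]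
    calc _ ≤ ∫⁻ y in A, ‖K x p * (c : ℂ) - K x y * (c : ℂ)‖ₑ ∂μ :=
          enorm_integral_le_lintegral_enorm _
      _ ≤ ∫⁻ y in A, ENNReal.ofReal ((2 * R) ^ ε / ‖p - x‖ ^ (1 + ε)) * c ∂μ := by
          refine setLIntegral_mono' hA fun y hy => ?_
          have hpy : ‖p - y‖ < R := by
            rw [← dist_eq_norm, dist_comm]
            exact hAR hy
          have hne : p ≠ x := by
            rintro rfl
            simp at hxp
            linarith
          rw [← sub_mul, enorm_mul]
          have hce : ‖(c : ℂ)‖ₑ = c := by simp [enorm_eq_nnnorm]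
          rw [hce, ← ofReal_norm]
          gcongr
          refine (hK.smooth_right p y x hne (by linarith)).trans ?_
          gcongr
          linarith
      _ = ENNReal.ofReal ((2 * R) ^ ε / ‖p - x‖ ^ (1 + ε)) * (c * μ A) := by
          rw [setLIntegral_const, mul_assoc]
      _ = α * ENNReal.ofReal ((2 * R) ^ ε / ‖p - x‖ ^ (1 + ε)) := by rw [hc, mul_comm]
  · have hp3 : p ∈ Metric.ball x (3 * r) := by
      rw [Metric.mem_ball, dist_eq_norm]
      linarith
    refine le_add_left ?_
    rw [indicator_of_mem hp3]
    have h1 : ‖(Metric.ball x r)ᶜ.indicator (fun y => (α : ℂ) * K x y) p‖ₑ ≤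
        α * ENNReal.ofReal (1 / r) := by
      by_cases hp : p ∈ (Metric.ball x r)ᶜ
      · rw [indicator_of_mem hp, hαe, ← ofReal_norm]
        gcongr
        exact hK.norm_le_of_notMem_ball hr hp
      · simp [indicator_of_notMem hp]
    have h2 : ‖∫ y in (Metric.ball x r)ᶜ, K x y * A.indicator (fun _ => (c : ℂ)) y ∂μ‖ₑ ≤
        α * ENNReal.ofReal (1 / r) := by
      calc _ ≤ ∫⁻ y in (Metric.ball x r)ᶜ, ‖K x y * A.indicator (fun _ => (c : ℂ)) y‖ₑ ∂μ :=
            enorm_integral_le_lintegral_enorm _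
        _ ≤ ∫⁻ y in (Metric.ball x r)ᶜ,
            A.indicator (fun _ => ENNReal.ofReal (1 / r) * (c : ℝ≥0∞)) y ∂μ := by
            refine setLIntegral_mono' measurableSet_ball.compl fun y hy => ?_
            by_cases hyA : y ∈ A
            · rw [indicator_of_mem hyA, indicator_of_mem hyA, enorm_mul, ← ofReal_norm (K x y)]
              have hce : ‖(c : ℂ)‖ₑ = c := by simp [enorm_eq_nnnorm]
              rw [hce]
              gcongr
              exact hK.norm_le_of_notMem_ball hr hy
            · simp [indicator_of_notMem hyA]
        _ ≤ ∫⁻ y, A.indicator (fun _ => ENNReal.ofReal (1 / r) * (c : ℝ≥0∞)) y ∂μ :=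
            setLIntegral_le_lintegral _ _
        _ = α * ENNReal.ofReal (1 / r) := by
            rw [lintegral_indicator_const hA, mul_assoc, hc, mul_comm]
    calc _ ≤ α * ENNReal.ofReal (1 / r) + α * ENNReal.ofReal (1 / r) :=
          enorm_sub_le.trans (add_le_add h1 h2)
      _ = α * (2 * ENNReal.ofReal (1 / r)) := by ring

/-! ### The weak (1,1) bound for finite sums of atoms. -/

/-- The weak `(2, 2)` constant of the maximal truncation. -/
noncomputable def weakTwoConst (ε : ℝ) (N : ℝ≥0∞) : ℝ≥0∞ :=
  cotlarConst ε N ^ 2 * (1 + N ^ 2)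

/-- The weak `(1, 1)` constant of the maximal truncation, at height `32 l`. -/
noncomputable def weakOneConst (ε : ℝ) (N : ℝ≥0∞) : ℝ≥0∞ :=
  1 + 6400 * weakTwoConst ε N +
    (tailConst ε + (40 ^ 4 + 42) + (1600 + 4 * weakTwoConst ε N))

theorem weakTwoConst_ne_top {ε : ℝ} (hε : 0 < ε) {N : ℝ≥0∞} (hN : N ≠ ∞) :
    weakTwoConst ε N ≠ ∞ := by
  have := tailConst_ne_top hε
  rw [weakTwoConst, cotlarConst]
  finiteness

theorem weakOneConst_ne_top {ε : ℝ} (hε : 0 < ε) {N : ℝ≥0∞} (hN : N ≠ ∞) :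
    weakOneConst ε N ≠ ∞ := by
  have h1 := tailConst_ne_top hε
  have h2 := weakTwoConst_ne_top hε hN
  rw [weakOneConst]
  finiteness

theorem setIntegral_sum_smul_dirac (s : Finset ℂ) (α : ℂ → ℝ≥0) (f : ℂ → ℂ) {S : Set ℂ}
    (hS : MeasurableSet S) :
    ∫ y in S, f y ∂(∑ p ∈ s, (α p : ℝ≥0∞) • Measure.dirac p) =
      ∑ p ∈ s, S.indicator (fun y => (α p : ℂ) * f y) p := by
  have hi : ∀ p ∈ s, Integrable (S.indicator f) ((α p : ℝ≥0∞) • Measure.dirac p) := fun p _ =>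
    (integrable_dirac (by simp)).smul_measure (by simp)
  rw [← integral_indicator hS, integral_finsetSum_measure hi]
  refine Finset.sum_congr rfl fun p _ => ?_
  rw [integral_smul_measure, integral_dirac]
  by_cases hp : p ∈ S
  · simp [hp]
  · simp [hp]

theorem sum_smul_dirac_apply (s : Finset ℂ) (α : ℂ → ℝ≥0) (S : Set ℂ) :
    (∑ p ∈ s, (α p : ℝ≥0∞) • Measure.dirac p) S =
      ∑ p ∈ s, S.indicator (fun _ => (α p : ℝ≥0∞)) p := by
  rw [Measure.finsetSum_apply]
  refine Finset.sum_congr rfl fun p _ => ?_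
  by_cases hp : p ∈ S <;> simp [hp]

section Spread

variable {ε : ℝ} {μ : Measure ℂ} {K : ℂ → ℂ → ℂ} {T : Lp ℂ 2 μ →L[ℂ] Lp ℂ 2 μ}

/-- The maximal truncation of a bounded function with bounded support, as a weak-type function. -/
theorem truncation_weak_type_bounded (hε : 0 < ε) (hμ : AhlforsCondition μ)
    (hK : IsCalderonZygmundKernel ε K) (hT : HasKernel μ K T) {f : ℂ → ℂ} (hf : Measurable f)
    {L : ℝ≥0} (hL : ∀ y, ‖f y‖ₑ ≤ L) {M : ℝ}
    (hM : ∀ y, y ∉ Metric.closedBall (0 : ℂ) M → f y = 0) (l : ℝ≥0∞) :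
    l ^ 2 * μ {x | l < ⨆ (r : ℝ) (_ : 0 < r), ‖∫ y in (Metric.ball x r)ᶜ, K x y * f y ∂μ‖ₑ} ≤
      weakTwoConst ε ‖T‖ₑ * (L * ∫⁻ x, ‖f x‖ₑ ∂μ) := by
  have := hμ.isLocallyFiniteMeasure
  have hf2 : MemLp f 2 μ := by
    have hind : (Metric.closedBall (0 : ℂ) M).indicator f = f := by
      ext y
      by_cases hy : y ∈ Metric.closedBall (0 : ℂ) M
      · rw [indicator_of_mem hy]
      · rw [indicator_of_notMem hy, hM y hy]
    rw [← hind, memLp_indicator_iff_restrict Metric.isClosed_closedBall.measurableSet]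
    have : IsFiniteMeasure (μ.restrict (Metric.closedBall (0 : ℂ) M)) :=
      ⟨by simpa using (isCompact_closedBall (0 : ℂ) M).measure_lt_top⟩
    refine MemLp.of_bound hf.aestronglyMeasurable L (ae_of_all _ fun y => ?_)
    have := hL y
    rw [enorm_eq_nnnorm, ENNReal.coe_le_coe] at this
    exact_mod_cast this
  refine (truncation_weak_type_two hε hμ hK hT hf hf2 hM l).trans ?_
  rw [weakTwoConst]
  gcongr
  rw [← lintegral_const_mul _ hf.enorm]
  refine lintegral_mono fun x => ?_
  rw [sq]
  gcongr
  exact hL x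

end Spread

/-- The weak `(1, 1)` estimate for finite sums of point masses. -/
theorem truncation_weak_type_one_of_atoms {ε : ℝ} (hε : 0 < ε) {μ : Measure ℂ}
    (hμ : AhlforsCondition μ) {K : ℂ → ℂ → ℂ} (hK : IsCalderonZygmundKernel ε K)
    {T : Lp ℂ 2 μ →L[ℂ] Lp ℂ 2 μ} (hT : HasKernel μ K T) (s : Finset ℂ) (α : ℂ → ℝ≥0)
    (hα : ∀ p ∈ s, α p ≠ 0) {l : ℝ≥0} (hl0 : l ≠ 0) :
    l * μ {x | ∃ r : ℝ, 0 < r ∧ 32 * (l : ℝ≥0∞) <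
      ‖∫ y in (Metric.ball x r)ᶜ, K x y ∂(∑ p ∈ s, (α p : ℝ≥0∞) • Measure.dirac p)‖ₑ} ≤
      weakOneConst ε ‖T‖ₑ * ∑ p ∈ s, (α p : ℝ≥0∞) := by
  set ν : Measure ℂ := ∑ p ∈ s, (α p : ℝ≥0∞) • Measure.dirac p with hν
  have hl0' : (l : ℝ≥0∞) ≠ 0 := by exact_mod_cast hl0
  have hνuniv : ν univ = ∑ p ∈ s, (α p : ℝ≥0∞) := by
    rw [hν, sum_smul_dirac_apply]
    simp
  set G : Set ℂ := {x | ∀ r : ℝ, 0 < r →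
    ν (Metric.ball x r) ≤ l * μ (Metric.ball x (5 * r))} with hG
  have hGc : l * μ Gᶜ ≤ ∑ p ∈ s, (α p : ℝ≥0∞) := by
    rw [← hνuniv]
    refine le_trans (le_of_eq ?_) (maximal_weak_type μ ν l)
    congr 2
    ext x
    simp [hG]
  -- Without good points the maximal estimate already bounds `l * μ univ`; stopping radii are
  -- distances to `G` and need it nonempty.
  rcases G.eq_empty_or_nonempty with hGe | hGne
  · rw [hGe, compl_empty] at hGc
    calc _ ≤ l * μ univ := by gcongr; exact subset_univ _
      _ ≤ 1 * ∑ p ∈ s, (α p : ℝ≥0∞) := by rwa [one_mul]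
      _ ≤ _ := by
        gcongr
        rw [weakOneConst, add_assoc]
        exact le_self_add
  have hatom : ∀ p ∈ s, ν {p} ≠ 0 := by
    intro p hp
    rw [hν, sum_smul_dirac_apply]
    intro h
    have := (Finset.sum_eq_zero_iff.1 h) p hp
    simp only [mem_singleton_iff, indicator_of_mem, ENNReal.coe_eq_zero] at this
    exact hα p hp this
  choose! ρ R hρ hR hρG hB0 hdbl hνB hpot using fun p (hp : p ∈ s) =>
    exists_stopping_radii hμ ENNReal.coe_ne_top hGne (fun z hz => hz) (hatom p hp)
  obtain ⟨A, hA, hAsum⟩ := exists_bounded_overlap_sets (L := 1600 * l) hμ.measure_ball_ne_top R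
    (fun p => α p) (by positivity) (by finiteness) s hB0 (fun p hp => by
      rw [← sum_smul_dirac_apply]
      exact hνB p hp)
  have hA0 : ∀ p ∈ s, μ (A p) ≠ 0 := fun p hp h => by
    have := (hA p hp).2.2
    rw [h, mul_zero] at this
    exact hB0 p hp (nonpos_iff_eq_zero.1 this)
  have hA1 : ∀ p ∈ s, μ (A p) ≠ ∞ := fun p hp =>
    ne_top_of_le_ne_top (hμ.measure_ball_ne_top p (R p)) (measure_mono (hA p hp).2.1)
  set c : ℂ → ℝ≥0 := fun p => (α p / μ (A p)).toNNReal with hc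
  have hcc : ∀ p ∈ s, (c p : ℝ≥0∞) = α p / μ (A p) := fun p hp =>
    ENNReal.coe_toNNReal (ENNReal.div_ne_top ENNReal.coe_ne_top (hA0 p hp))
  have hcα : ∀ p ∈ s, (c p : ℝ≥0∞) * μ (A p) = α p := fun p hp => by
    rw [hcc p hp]
    exact ENNReal.div_mul_cancel (hA0 p hp) (hA1 p hp)
  set φ : ℂ → ℂ → ℂ := fun p => (A p).indicator fun _ => (c p : ℂ) with hφ
  have hφm : ∀ p ∈ s, Measurable (φ p) := fun p hp => measurable_const.indicator (hA p hp).1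
  have hφe : ∀ p y, ‖φ p y‖ₑ = (A p).indicator (fun _ => (c p : ℝ≥0∞)) y := fun p y => by
    by_cases hy : y ∈ A p
    · simp [hφ, hy, enorm_eq_nnnorm]
    · simp [hφ, hy]
  have hφle : ∀ p y, ‖φ p y‖ₑ ≤ c p := fun p y => by
    rw [hφe]
    exact indicator_apply_le' (fun _ => le_rfl) fun _ => zero_le
  have hφint : ∀ p ∈ s, ∫⁻ y, ‖φ p y‖ₑ ∂μ = α p := fun p hp => by
    simp only [hφe]
    rw [lintegral_indicator_const (hA p hp).1, hcα p hp]
  have hφsupp : ∀ p ∈ s, ∀ y, y ∉ Metric.closedBall (0 : ℂ) (‖p‖ + R p) → φ p y = 0 := by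
    intro p hp y hy
    refine indicator_of_notMem (fun hyA => hy ?_) _
    have h1 : dist y p < R p := (hA p hp).2.1 hyA
    have h2 := dist_triangle y p 0
    rw [dist_zero_right p] at h2
    rw [Metric.mem_closedBall]
    linarith
  have hφi : ∀ p ∈ s, Integrable (φ p) μ := fun p hp =>
    ⟨(hφm p hp).aestronglyMeasurable, by
      rw [HasFiniteIntegral, hφint p hp]; exact ENNReal.coe_lt_top⟩
  set S : (ℂ → ℂ) → ℂ → ℝ≥0∞ := fun f x =>
    ⨆ (r : ℝ) (_ : 0 < r), ‖∫ y in (Metric.ball x r)ᶜ, K x y * f y ∂μ‖ₑ with hS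
  have hSle : ∀ (f : ℂ → ℂ) (x : ℂ) {r : ℝ}, 0 < r →
      ‖∫ y in (Metric.ball x r)ᶜ, K x y * f y ∂μ‖ₑ ≤ S f x := fun f x r hr =>
    le_iSup₂ (f := fun (r : ℝ) (_ : 0 < r) =>
      ‖∫ y in (Metric.ball x r)ᶜ, K x y * f y ∂μ‖ₑ) r hr
  -- The majorant is taken with base level `α p / b`, the mean density of the atom over its ball.
  -- The weak (2,2) bound then yields a local integral proportional to `α p`.
  have hmaj : ∀ p ∈ s, ∃ H : ℂ → ℝ≥0∞, Measurable H ∧ (∀ x, S (φ p) x ≤ H x) ∧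
      ∫⁻ x in Metric.ball p (2 * R p), H x ∂μ ≤ (1600 + 4 * weakTwoConst ε ‖T‖ₑ) * α p := by
    intro p hp
    set b := μ (Metric.ball p (R p)) with hb
    have hb0 : b ≠ 0 := hB0 p hp
    have hb1 : b ≠ ∞ := hμ.measure_ball_ne_top p (R p)
    have hα0 : (α p : ℝ≥0∞) ≠ 0 := by exact_mod_cast hα p hp
    have hd0 : (α p : ℝ≥0∞) / b ≠ 0 := ENNReal.div_ne_zero.2 ⟨hα0, hb1⟩
    have hd1 : (α p : ℝ≥0∞) / b ≠ ∞ := ENNReal.div_ne_top ENNReal.coe_ne_top hb0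
    obtain ⟨H, hHm, hHle, hHint⟩ := exists_measurable_majorant μ (S (φ p))
      (Metric.ball p (2 * R p)) (α p / b) _ hd0 hd1 fun l _ _ =>
        truncation_weak_type_bounded hε hμ hK hT (hφm p hp) (hφle p) (hφsupp p hp) l
    refine ⟨H, hHm, hHle, hHint.trans ?_⟩
    have hcb : (c p : ℝ≥0∞) ≤ 2 * (α p / b) := by
      rw [hcc p hp]
      refine ENNReal.div_le_of_le_mul ?_
      calc (α p : ℝ≥0∞) = α p / b * b := (ENNReal.div_mul_cancel hb0 hb1).symm
        _ ≤ α p / b * (2 * μ (A p)) := by gcongr; exact (hA p hp).2.2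
        _ = 2 * (α p / b) * μ (A p) := by ring
    have h1 : α p / b * μ (Metric.ball p (2 * R p)) ≤ 1600 * α p :=
      calc _ ≤ α p / b * (1600 * b) := by gcongr; exact hdbl p hp
        _ = 1600 * (α p / b * b) := by ring
        _ = 1600 * α p := by rw [ENNReal.div_mul_cancel hb0 hb1]
    have h2 : weakTwoConst ε ‖T‖ₑ * (c p * ∫⁻ x, ‖φ p x‖ₑ ∂μ) / (α p / b) ≤
        2 * weakTwoConst ε ‖T‖ₑ * α p := by
      refine ENNReal.div_le_of_le_mul ?_
      rw [hφint p hp]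
      calc _ ≤ weakTwoConst ε ‖T‖ₑ * (2 * (α p / b) * α p) := by gcongr
        _ = _ := by ring
    calc _ ≤ 1600 * (α p : ℝ≥0∞) + 2 * (2 * weakTwoConst ε ‖T‖ₑ * α p) := by gcongr
      _ = _ := by ring
  choose! H hHm hHle hHint using hmaj
  -- An error independent of `r`: the smoothness tail far from `p`, and near `p` the kernel of the
  -- atom plus the maximal truncation of its spread. The disk of radius `ρ p` is left out because it
  -- contains no good point.
  set E : ℂ → ℂ → ℝ≥0∞ := fun p x =>
    (Metric.ball p (2 * R p))ᶜ.indicator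
      (fun x => α p * ENNReal.ofReal ((2 * R p) ^ ε / ‖p - x‖ ^ (1 + ε))) x +
    ((Metric.ball p (2 * R p) \ Metric.ball p (ρ p)).indicator
      (fun x => α p * ENNReal.ofReal (1 / ‖p - x‖)) x +
    (Metric.ball p (2 * R p)).indicator (H p) x) with hE
  have hm1 : ∀ p, Measurable ((Metric.ball p (2 * R p))ᶜ.indicator
      (fun x => α p * ENNReal.ofReal ((2 * R p) ^ ε / ‖p - x‖ ^ (1 + ε)))) := fun p =>
    Measurable.indicator (by fun_prop) measurableSet_ball.compl
  have hm2 : ∀ p, Measurable ((Metric.ball p (2 * R p) \ Metric.ball p (ρ p)).indicator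
      (fun x => α p * ENNReal.ofReal (1 / ‖p - x‖))) := fun p =>
    Measurable.indicator (by fun_prop) (measurableSet_ball.diff measurableSet_ball)
  have hm3 : ∀ p ∈ s, Measurable ((Metric.ball p (2 * R p)).indicator (H p)) := fun p hp =>
    (hHm p hp).indicator measurableSet_ball
  have hEm : ∀ p ∈ s, Measurable (E p) := fun p hp => (hm1 p).add ((hm2 p).add (hm3 p hp))
  have hEint : ∀ p ∈ s, ∫⁻ x, E p x ∂μ ≤
      (tailConst ε + (40 ^ 4 + 42) + (1600 + 4 * weakTwoConst ε ‖T‖ₑ)) * α p := by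
    intro p hp
    have h2R : 0 < 2 * R p := by have := hR p hp; positivity
    rw [hE, lintegral_add_left (hm1 p), lintegral_add_left (hm2 p),
      lintegral_indicator measurableSet_ball.compl,
      lintegral_indicator (measurableSet_ball.diff measurableSet_ball),
      lintegral_indicator measurableSet_ball, lintegral_const_mul _ (by fun_prop),
      lintegral_const_mul _ (by fun_prop)]
    have htail := lintegral_tail_le μ p hε h2R 1 fun r hr => by
      rw [one_mul]
      exact hμ p r (by linarith)
    calc _ ≤ α p * (tailConst ε * 1) + (α p * (40 ^ 4 + 42) +
          (1600 + 4 * weakTwoConst ε ‖T‖ₑ) * α p) := by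
          gcongr
          · exact hpot p hp
          · exact hHint p hp
      _ = _ := by ring
  have hterm : ∀ p ∈ s, ∀ x ∈ G, ∀ r : ℝ, 0 < r →
      ‖(Metric.ball x r)ᶜ.indicator (fun y => (α p : ℂ) * K x y) p -
        ∫ y in (Metric.ball x r)ᶜ, K x y * φ p y ∂μ‖ₑ ≤
      E p x + (Metric.ball x (3 * r)).indicator
        (fun _ => (α p : ℝ≥0∞) * (2 * ENNReal.ofReal (1 / r))) p := by
    intro p hp x hx r hr
    by_cases hxp : x ∈ Metric.ball p (2 * R p)
    · refine le_add_right ?_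
      have hxρ : x ∈ Metric.ball p (2 * R p) \ Metric.ball p (ρ p) := ⟨hxp, hρG p hp x hx⟩
      have hne : x ≠ p := by
        rintro rfl
        exact hρG x hp x hx (Metric.mem_ball_self (hρ x hp))
      simp only [hE]
      rw [indicator_of_notMem (notMem_compl_iff.2 hxp), zero_add, indicator_of_mem hxρ,
        indicator_of_mem hxp]
      refine enorm_sub_le.trans (add_le_add ?_ ((hSle _ x hr).trans (hHle p hp x)))
      by_cases hpr : p ∈ (Metric.ball x r)ᶜ
      · rw [indicator_of_mem hpr, enorm_mul, norm_sub_rev]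
        have hce : ‖(α p : ℂ)‖ₑ = α p := by simp [enorm_eq_nnnorm]
        rw [hce]
        gcongr
        exact hK.enorm_le hne
      · simp [indicator_of_notMem hpr]
    · refine (enorm_atom_sub_spread_le hε hK (hR p hp) hr (hA p hp).1 (hA p hp).2.1 (hA1 p hp)
        (hcα p hp) hxp).trans ?_
      gcongr
      simp only [hE]
      rw [indicator_of_mem (mem_compl hxp)]
      exact le_self_add
  set g : ℂ → ℂ := fun y => ∑ p ∈ s, φ p y with hg
  have hpt : ∀ x ∈ G, ∀ r : ℝ, 0 < r → ‖∫ y in (Metric.ball x r)ᶜ, K x y ∂ν‖ₑ ≤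
      S g x + (∑ p ∈ s, E p x + 30 * l) := by
    intro x hx r hr
    have hgsum : ∫ y in (Metric.ball x r)ᶜ, K x y * g y ∂μ =
        ∑ p ∈ s, ∫ y in (Metric.ball x r)ᶜ, K x y * φ p y ∂μ := by
      simp only [hg, Finset.mul_sum]
      exact integral_finsetSum _ fun p hp => hK.integrableOn_mul hε x hr (hφi p hp)
    have hdecomp : ∫ y in (Metric.ball x r)ᶜ, K x y ∂ν =
        (∫ y in (Metric.ball x r)ᶜ, K x y * g y ∂μ) +
        ∑ p ∈ s, ((Metric.ball x r)ᶜ.indicator (fun y => (α p : ℂ) * K x y) p -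
          ∫ y in (Metric.ball x r)ᶜ, K x y * φ p y ∂μ) := by
      rw [Finset.sum_sub_distrib, ← hgsum, add_sub_cancel,
        setIntegral_sum_smul_dirac s α _ measurableSet_ball.compl]
    -- The only error depending on `r`: goodness of `x` gives `ν (B(x, 3r)) ≤ 15 l r`, multiplied by
    -- `2 / r`.
    have hbdry : ∑ p ∈ s, (Metric.ball x (3 * r)).indicator
        (fun _ => (α p : ℝ≥0∞) * (2 * ENNReal.ofReal (1 / r))) p ≤ 30 * l := by
      calc _ = ν (Metric.ball x (3 * r)) * (2 * ENNReal.ofReal (1 / r)) := by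
            rw [hν, sum_smul_dirac_apply, Finset.sum_mul]
            refine Finset.sum_congr rfl fun p _ => ?_
            by_cases hp : p ∈ Metric.ball x (3 * r)
            · rw [indicator_of_mem hp, indicator_of_mem hp]
            · rw [indicator_of_notMem hp, indicator_of_notMem hp, zero_mul]
        _ ≤ l * ENNReal.ofReal (5 * (3 * r)) * (2 * ENNReal.ofReal (1 / r)) := by
            gcongr
            refine (hx (3 * r) (by positivity)).trans ?_
            gcongr
            exact hμ _ _ (by positivity)
        _ = 2 * l * ENNReal.ofReal (5 * (3 * r) * (1 / r)) := by
            rw [ENNReal.ofReal_mul (p := 5 * (3 * r)) (by positivity)]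
            ring
        _ = 30 * l := by
            rw [show 5 * (3 * r) * (1 / r) = 15 by field_simp; norm_num]
            norm_num
            ring
    rw [hdecomp]
    refine (enorm_add_le _ _).trans (add_le_add (hSle g x hr) ?_)
    refine (enorm_sum_le _ _).trans ((Finset.sum_le_sum fun p hp => hterm p hp x hx r hr).trans ?_)
    rw [Finset.sum_add_distrib]
    gcongr
  -- The height splits as `32 = 1 + 1 + 30`: spread function, integrable errors, boundary term.
  have hsub : {x | ∃ r : ℝ, 0 < r ∧ 32 * (l : ℝ≥0∞) < ‖∫ y in (Metric.ball x r)ᶜ, K x y ∂ν‖ₑ} ⊆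
      Gᶜ ∪ ({x | (l : ℝ≥0∞) < S g x} ∪ {x | (l : ℝ≥0∞) ≤ ∑ p ∈ s, E p x}) := by
    rintro x ⟨r, hr, hxr⟩
    by_contra hcon
    simp only [mem_union, mem_compl_iff, not_or, not_not, mem_ofPred_eq, not_lt, not_le] at hcon
    obtain ⟨h1, h2, h3⟩ := hcon
    refine absurd (hpt x h1 r hr) (not_le.2 (lt_of_le_of_lt ?_ hxr))
    calc _ ≤ (l : ℝ≥0∞) + (l + 30 * l) := by gcongr
      _ = 32 * l := by ring
  have hgm : Measurable g := Finset.measurable_fun_sum _ fun p hp => hφm p hp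
  have hge : ∀ y, ‖g y‖ₑ ≤ ∑ p ∈ s, ‖φ p y‖ₑ := fun y => enorm_sum_le _ _
  -- `6400 = 4 * 1600`: the overlap lemma applied with `L = 1600 * l`.
  have hgle : ∀ y, ‖g y‖ₑ ≤ ((6400 * l : ℝ≥0) : ℝ≥0∞) := by
    intro y
    calc ‖g y‖ₑ ≤ ∑ p ∈ s, (A p).indicator (fun _ => (α p : ℝ≥0∞) / μ (A p)) y := by
          refine (hge y).trans (Finset.sum_le_sum fun p hp => ?_)
          rw [hφe, hcc p hp]
      _ ≤ 4 * (1600 * l) := hAsum y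
      _ = ((6400 * l : ℝ≥0) : ℝ≥0∞) := by push_cast; ring
  have hgint : ∫⁻ y, ‖g y‖ₑ ∂μ ≤ ∑ p ∈ s, (α p : ℝ≥0∞) := by
    calc _ ≤ ∫⁻ y, ∑ p ∈ s, ‖φ p y‖ₑ ∂μ := lintegral_mono hge
      _ = ∑ p ∈ s, ∫⁻ y, ‖φ p y‖ₑ ∂μ :=
        lintegral_finsetSum' _ fun p hp => (hφm p hp).enorm.aemeasurable
      _ = _ := Finset.sum_congr rfl hφint
  have hgsupp : ∀ y, y ∉ Metric.closedBall (0 : ℂ) (∑ p ∈ s, (‖p‖ + R p)) → g y = 0 := by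
    intro y hy
    refine Finset.sum_eq_zero fun p hp => hφsupp p hp y fun hyp => hy ?_
    refine Metric.closedBall_subset_closedBall ?_ hyp
    exact Finset.single_le_sum (f := fun p => ‖p‖ + R p)
      (fun q hq => add_nonneg (norm_nonneg q) (hR q hq).le) hp
  have hgood : l * μ {x | (l : ℝ≥0∞) < S g x} ≤
      6400 * weakTwoConst ε ‖T‖ₑ * ∑ p ∈ s, (α p : ℝ≥0∞) := by
    rw [← ENNReal.mul_le_mul_iff_right hl0' ENNReal.coe_ne_top]
    calc _ = (l : ℝ≥0∞) ^ 2 * μ {x | (l : ℝ≥0∞) < S g x} := by ring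
      _ ≤ weakTwoConst ε ‖T‖ₑ * (((6400 * l : ℝ≥0) : ℝ≥0∞) * ∫⁻ x, ‖g x‖ₑ ∂μ) :=
        truncation_weak_type_bounded hε hμ hK hT hgm hgle hgsupp l
      _ ≤ weakTwoConst ε ‖T‖ₑ * (((6400 * l : ℝ≥0) : ℝ≥0∞) * ∑ p ∈ s, (α p : ℝ≥0∞)) := by
        gcongr
      _ = _ := by push_cast; ring
  have hbad : l * μ {x | (l : ℝ≥0∞) ≤ ∑ p ∈ s, E p x} ≤
      (tailConst ε + (40 ^ 4 + 42) + (1600 + 4 * weakTwoConst ε ‖T‖ₑ)) *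
        ∑ p ∈ s, (α p : ℝ≥0∞) := by
    refine (mul_meas_ge_le_lintegral (Finset.measurable_fun_sum _ fun p hp => hEm p hp) _).trans ?_
    rw [lintegral_finsetSum' _ fun p hp => (hEm p hp).aemeasurable, Finset.mul_sum]
    exact Finset.sum_le_sum hEint
  calc _ ≤ l * (μ Gᶜ + (μ {x | (l : ℝ≥0∞) < S g x} + μ {x | (l : ℝ≥0∞) ≤ ∑ p ∈ s, E p x})) := by
        gcongr
        refine (measure_mono hsub).trans ((measure_union_le _ _).trans ?_)
        gcongr
        exact measure_union_le _ _
    _ ≤ ∑ p ∈ s, (α p : ℝ≥0∞) + (6400 * weakTwoConst ε ‖T‖ₑ * ∑ p ∈ s, (α p : ℝ≥0∞) +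
        (tailConst ε + (40 ^ 4 + 42) + (1600 + 4 * weakTwoConst ε ‖T‖ₑ)) *
          ∑ p ∈ s, (α p : ℝ≥0∞)) := by
        rw [mul_add, mul_add]
        gcongr
    _ = _ := by rw [weakOneConst]; ring

/-! ### From atoms to finite measures. -/

theorem map_simpleFunc_eq_sum (ν : Measure ℂ) (f : SimpleFunc ℂ ℂ) :
    ν.map f = ∑ p ∈ f.range with ν (f ⁻¹' {p}) ≠ 0, ν (f ⁻¹' {p}) • Measure.dirac p := by
  classical
  ext S hS
  rw [Measure.map_apply f.measurable hS, Measure.finsetSum_apply]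
  have h : f ⁻¹' S = f ⁻¹' (f.range.filter (· ∈ S) : Finset ℂ) := by
    ext y
    simp
  rw [h, ← sum_measure_preimage_singleton _ fun y _ => f.measurableSet_fiber y,
    Finset.sum_filter, Finset.sum_filter]
  refine Finset.sum_congr rfl fun p _ => ?_
  by_cases hp : p ∈ S <;> by_cases h0 : ν (f ⁻¹' {p}) = 0 <;> simp [hp, h0]

section Approximation

variable {ε : ℝ} {K : ℂ → ℂ → ℂ} (ν : Measure ℂ) [IsFiniteMeasure ν]

/-- Truncated integrals are left continuous in the radius. -/
theorem tendsto_truncation_left (hε : 0 < ε) (hK : IsCalderonZygmundKernel ε K) (x : ℂ) {r : ℝ}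
    (hr : 0 < r) :
    Filter.Tendsto (fun r' => ∫ y in (Metric.ball x r')ᶜ, K x y ∂ν) (nhdsWithin r (Iio r))
      (nhds (∫ y in (Metric.ball x r)ᶜ, K x y ∂ν)) := by
  simp only [← integral_indicator measurableSet_ball.compl]
  have hev : ∀ᶠ r' in nhdsWithin r (Iio r), r / 2 < r' ∧ r' < r :=
    Ioo_mem_nhdsLT (by linarith)
  refine tendsto_integral_filter_of_dominated_convergence (fun _ => 2 / r) ?_ ?_
    (integrable_const _) (ae_of_all _ fun y => ?_)
  · filter_upwards [hev] with r' hr'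
    exact (aestronglyMeasurable_indicator_iff measurableSet_ball.compl).2
      (hK.aestronglyMeasurable hε x (by linarith) ν)
  · filter_upwards [hev] with r' hr'
    refine ae_of_all _ fun y => ?_
    by_cases hy : y ∈ (Metric.ball x r')ᶜ
    · rw [indicator_of_mem hy]
      refine (hK.norm_le_of_notMem_ball (show 0 < r / 2 by positivity) fun h => hy ?_).trans
        (le_of_eq (by field_simp))
      exact Metric.ball_subset_ball hr'.1.le h
    · rw [indicator_of_notMem hy, norm_zero]
      positivity
  -- Because the balls are open, membership of a fixed `y` is eventually constant as `r'` increases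
  -- to `r`.
  · refine tendsto_const_nhds.congr' ?_
    by_cases hy : y ∈ Metric.ball x r
    · have hlt : ∀ᶠ r' in nhdsWithin r (Iio r), dist y x < r' ∧ r' < r := Ioo_mem_nhdsLT hy
      filter_upwards [hlt] with r' hr'
      rw [indicator_of_notMem (notMem_compl_iff.2 hy),
        indicator_of_notMem (notMem_compl_iff.2 (Metric.mem_ball.2 hr'.1))]
    · filter_upwards [hev] with r' hr'
      rw [indicator_of_mem (mem_compl hy), indicator_of_mem (mem_compl fun h => hy
        (Metric.ball_subset_ball hr'.2.le h))]

/-- Truncated integrals at a radius whose sphere is null are limits of truncated integrals of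
push-forwards under simple functions converging to the identity. -/
theorem tendsto_truncation_map (hε : 0 < ε) (hK : IsCalderonZygmundKernel ε K) (x : ℂ) {r : ℝ}
    (hr : 0 < r) (hnull : ν (Metric.sphere x r) = 0) {f : ℕ → SimpleFunc ℂ ℂ}
    (hf : ∀ y, Filter.Tendsto (fun n => f n y) Filter.atTop (nhds y)) :
    Filter.Tendsto (fun n => ∫ y in (Metric.ball x r)ᶜ, K x y ∂(ν.map (f n))) Filter.atTop
      (nhds (∫ y in (Metric.ball x r)ᶜ, K x y ∂ν)) := by
  have hF : ∀ σ : Measure ℂ, AEStronglyMeasurable ((Metric.ball x r)ᶜ.indicator (K x)) σ :=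
    fun σ => (aestronglyMeasurable_indicator_iff measurableSet_ball.compl).2
      (hK.aestronglyMeasurable hε x hr σ)
  have hbd : ∀ y, ‖(Metric.ball x r)ᶜ.indicator (K x) y‖ ≤ 1 / r := fun y => by
    by_cases hy : y ∈ (Metric.ball x r)ᶜ
    · rw [indicator_of_mem hy]
      exact hK.norm_le_of_notMem_ball hr hy
    · rw [indicator_of_notMem hy, norm_zero]
      positivity
  simp only [← integral_indicator measurableSet_ball.compl]
  simp only [fun n => integral_map (f n).measurable.aemeasurable (hF (ν.map (f n)))]
  refine tendsto_integral_of_dominated_convergence (fun _ => 1 / r)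
    (fun n => (hF (ν.map (f n))).comp_measurable (f n).measurable)
    (integrable_const _) (fun n => ae_of_all _ fun y => hbd _) ?_
  have hae : ∀ᵐ y ∂ν, y ∉ Metric.sphere x r := measure_eq_zero_iff_ae_notMem.1 hnull
  filter_upwards [hae] with y hy
  -- The truncated kernel can jump only on the sphere, which is `ν`-null.
  have hcont : ContinuousAt ((Metric.ball x r)ᶜ.indicator (K x)) y := by
    rcases lt_or_gt_of_ne (show dist y x ≠ r from hy) with h | h
    · refine (continuousAt_const (y := (0 : ℂ))).congr ?_
      filter_upwards [Metric.isOpen_ball.mem_nhds h] with z hz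
      rw [indicator_of_notMem (notMem_compl_iff.2 hz)]
    · have hyx : y ≠ x := by
        rintro rfl
        rw [dist_self] at h
        linarith
      refine ((hK.continuousOn_compl_singleton hε x).continuousAt
        (isOpen_compl_singleton.mem_nhds hyx)).congr ?_
      have hmem : (Metric.closedBall x r)ᶜ ∈ nhds y :=
        Metric.isClosed_closedBall.isOpen_compl.mem_nhds (by simpa using h)
      filter_upwards [hmem] with z hz
      rw [indicator_of_mem (mem_compl fun hzb => hz (Metric.ball_subset_closedBall hzb))]
  exact hcont.tendsto.comp (hf y)

/-- Concentric spheres are disjoint, so only countably many are charged; left continuity lets the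
radius decrease slightly to avoid them. -/
theorem exists_null_sphere_truncation_gt (hε : 0 < ε) (hK : IsCalderonZygmundKernel ε K) (x : ℂ)
    {r : ℝ} (hr : 0 < r) {a : ℝ≥0∞} (ha : a < ‖∫ y in (Metric.ball x r)ᶜ, K x y ∂ν‖ₑ) :
    ∃ r', 0 < r' ∧ ν (Metric.sphere x r') = 0 ∧
      a < ‖∫ y in (Metric.ball x r')ᶜ, K x y ∂ν‖ₑ := by
  have hev := ((tendsto_truncation_left ν hε hK x hr).enorm.eventually_const_lt ha).and
    (Ioo_mem_nhdsLT (by linarith : r / 2 < r))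
  obtain ⟨b, hb, hsub⟩ := (mem_nhdsLT_iff_exists_Ioo_subset' (show r / 2 < r by linarith)).1 hev
  have hcount : {r' : ℝ | 0 < ν (Metric.sphere x r')}.Countable := by
    refine Measure.countable_meas_pos_of_disjoint_iUnion
      (fun r' => Metric.isClosed_sphere.measurableSet) fun r₁ r₂ hne => ?_
    refine Set.disjoint_left.2 fun y h1 h2 => hne ?_
    rw [← Metric.mem_sphere.1 h1, ← Metric.mem_sphere.1 h2]
  obtain ⟨r', hr', hbr⟩ := (hcount.dense_compl ℝ).exists_between hb
  obtain ⟨h1, h2⟩ := hsub hbr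
  refine ⟨r', by linarith [h2.1], ?_, h1⟩
  simpa using hr'

end Approximation

/-- The weak `(1, 1)` estimate for finite positive measures. -/
theorem truncation_weak_type_one {ε : ℝ} (hε : 0 < ε) {μ : Measure ℂ}
    (hμ : AhlforsCondition μ) {K : ℂ → ℂ → ℂ} (hK : IsCalderonZygmundKernel ε K)
    {T : Lp ℂ 2 μ →L[ℂ] Lp ℂ 2 μ} (hT : HasKernel μ K T) (ν : Measure ℂ) [IsFiniteMeasure ν]
    {l : ℝ≥0} (hl0 : l ≠ 0) :
    l * μ {x | ∃ r : ℝ, 0 < r ∧ 32 * (l : ℝ≥0∞) < ‖∫ y in (Metric.ball x r)ᶜ, K x y ∂ν‖ₑ} ≤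
      weakOneConst ε ‖T‖ₑ * ν univ := by
  set f : ℕ → SimpleFunc ℂ ℂ := SimpleFunc.approxOn id measurable_id univ 0 (mem_univ 0) with hf
  have hlim : ∀ y, Filter.Tendsto (fun n => f n y) Filter.atTop (nhds y) := fun y =>
    SimpleFunc.tendsto_approxOn measurable_id (mem_univ 0) (by simp)
  set S : ℕ → Set ℂ := fun n => {x | ∃ r : ℝ, 0 < r ∧
    32 * (l : ℝ≥0∞) < ‖∫ y in (Metric.ball x r)ᶜ, K x y ∂(ν.map (f n))‖ₑ} with hS
  have hSn : ∀ n, l * μ (S n) ≤ weakOneConst ε ‖T‖ₑ * ν univ := by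
    intro n
    set α : ℂ → ℝ≥0 := fun p => (ν (f n ⁻¹' {p})).toNNReal with hα
    have hαc : ∀ p, (α p : ℝ≥0∞) = ν (f n ⁻¹' {p}) := fun p =>
      ENNReal.coe_toNNReal (measure_ne_top _ _)
    have hmap : ν.map (f n) = ∑ p ∈ (f n).range with ν (f n ⁻¹' {p}) ≠ 0,
        (α p : ℝ≥0∞) • Measure.dirac p := by
      simp only [hαc]
      exact map_simpleFunc_eq_sum ν (f n)
    have hmass : ∑ p ∈ (f n).range with ν (f n ⁻¹' {p}) ≠ 0, (α p : ℝ≥0∞) = ν univ := by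
      have h : ν.map (f n) univ = ν univ := by
        rw [Measure.map_apply (f n).measurable MeasurableSet.univ, preimage_univ]
      rw [← h, hmap, sum_smul_dirac_apply]
      simp
    simp only [hS, hmap, ← hmass]
    refine truncation_weak_type_one_of_atoms hε hμ hK hT _ α (fun p hp h => ?_) hl0
    refine (Finset.mem_filter.1 hp).2 ?_
    rw [← hαc, h, ENNReal.coe_zero]
  -- A Fatou argument for sets: the strict inequality at a null radius persists for all large `n`,
  -- so the level set lies in the lower limit of the `S n`, whose bounds are uniform.
  have hsub : {x | ∃ r : ℝ, 0 < r ∧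
      32 * (l : ℝ≥0∞) < ‖∫ y in (Metric.ball x r)ᶜ, K x y ∂ν‖ₑ} ⊆ ⋃ N, ⋂ n ≥ N, S n := by
    rintro x ⟨r, hr, hxr⟩
    obtain ⟨r', hr', hnull, hxr'⟩ := exists_null_sphere_truncation_gt ν hε hK x hr hxr
    have hev := (tendsto_truncation_map ν hε hK x hr' hnull hlim).enorm.eventually_const_lt hxr'
    obtain ⟨N, hN⟩ := Filter.eventually_atTop.1 hev
    exact mem_iUnion.2 ⟨N, mem_iInter₂.2 fun n hn => ⟨r', hr', hN n hn⟩⟩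
  have hmono : Monotone fun N => ⋂ n ≥ N, S n := fun N₁ N₂ h =>
    biInter_subset_biInter_left fun n hn => le_trans h hn
  refine (mul_le_mul' le_rfl (measure_mono hsub)).trans ?_
  rw [hmono.measure_iUnion, ENNReal.mul_iSup]
  exact iSup_le fun N => (mul_le_mul' le_rfl
    (measure_mono (biInter_subset_of_mem (show N ≥ N from le_rfl)))).trans (hSn N)

/-! ### Signed measures and the final constant. -/

theorem truncatedOp_eq_sub {ε : ℝ} (hε : 0 < ε) {K : ℂ → ℂ → ℂ}
    (hK : IsCalderonZygmundKernel ε K) (ν : SignedMeasure ℂ) {r : ℝ} (hr : 0 < r) (x : ℂ) :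
    truncatedOp K r ν x =
      (∫ y in (Metric.ball x r)ᶜ, K x y ∂ν.toJordanDecomposition.posPart) -
        ∫ y in (Metric.ball x r)ᶜ, K x y ∂ν.toJordanDecomposition.negPart := by
  have hm : MeasurableSet (Metric.ball x r)ᶜ := measurableSet_ball.compl
  have hrestr : VectorMeasure.restrict ν (Metric.ball x r)ᶜ =
      (ν.toJordanDecomposition.posPart.restrict (Metric.ball x r)ᶜ).toSignedMeasure -
      (ν.toJordanDecomposition.negPart.restrict (Metric.ball x r)ᶜ).toSignedMeasure := by
    conv_lhs => rw [← ν.toSignedMeasure_toJordanDecomposition]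
    ext s hs
    rw [VectorMeasure.restrict_apply _ hm hs, JordanDecomposition.toSignedMeasure,
      sub_apply, sub_apply,
      Measure.toSignedMeasure_apply_measurable (hs.inter hm),
      Measure.toSignedMeasure_apply_measurable (hs.inter hm),
      Measure.toSignedMeasure_apply_measurable hs, Measure.toSignedMeasure_apply_measurable hs,
      measureReal_restrict_apply hs, measureReal_restrict_apply hs]
  have hint : ∀ (σ : Measure ℂ) [IsFiniteMeasure σ],
      (σ.restrict (Metric.ball x r)ᶜ).toSignedMeasure.Integrable (K x) := fun σ _ => by
    rw [VectorMeasure.Integrable, Measure.variation_toSignedMeasure]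
    exact hK.integrableOn hε x hr σ
  rw [truncatedOp, hrestr, VectorMeasure.integral_sub_vectorMeasure (hint _) (hint _),
    VectorMeasure.integral_toSignedMeasure, VectorMeasure.integral_toSignedMeasure]

theorem theorem3 :
    ∃ A : ℝ → ℝ → ℝ, ∀ (ε : ℝ), 0 < ε →
      ∀ (μ : Measure ℂ), AhlforsCondition μ →
      ∀ (K : ℂ → ℂ → ℂ), IsCalderonZygmundKernel ε K →
      ∀ (T : Lp ℂ 2 μ →L[ℂ] Lp ℂ 2 μ), HasKernel μ K T →
      ∀ (ν : SignedMeasure ℂ) (t : ℝ), 0 < t →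
        μ {x : ℂ | ENNReal.ofReal t < maximalOp K ν x} ≤
          ENNReal.ofReal (A ε ‖T‖) * ν.totalVariation univ / ENNReal.ofReal t := by
  -- `64 = 2 * 32`: if the truncation exceeds `t = 64 * l`, the positive or the negative part
  -- contributes more than `32 * l`.
  refine ⟨fun ε N => (64 * weakOneConst ε (ENNReal.ofReal N)).toReal,
    fun ε hε μ hμ K hK T hT ν t ht => ?_⟩
  have hA : ENNReal.ofReal (64 * weakOneConst ε (ENNReal.ofReal ‖T‖)).toReal =
      64 * weakOneConst ε ‖T‖ₑ := by
    rw [ENNReal.ofReal_toReal (ENNReal.mul_ne_top (by norm_num)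
      (weakOneConst_ne_top hε ENNReal.ofReal_ne_top)), ofReal_norm]
  rw [hA]
  set l : ℝ≥0 := (t / 64).toNNReal with hl
  have hl0 : l ≠ 0 := (Real.toNNReal_pos.2 (by positivity)).ne'
  have htl : ENNReal.ofReal t = 64 * (l : ℝ≥0∞) := by
    rw [hl, ← ENNReal.ofReal, show (64 : ℝ≥0∞) = ENNReal.ofReal 64 by norm_num,
      ← ENNReal.ofReal_mul (by norm_num)]
    congr 1
    ring
  set P := ν.toJordanDecomposition.posPart with hP
  set N := ν.toJordanDecomposition.negPart with hN
  set E : Measure ℂ → Set ℂ := fun σ => {x | ∃ r : ℝ, 0 < r ∧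
    32 * (l : ℝ≥0∞) < ‖∫ y in (Metric.ball x r)ᶜ, K x y ∂σ‖ₑ} with hE
  have hsub : {x : ℂ | ENNReal.ofReal t < maximalOp K ν x} ⊆ E P ∪ E N := by
    intro x hx
    obtain ⟨r, hr, hxr⟩ : ∃ r : ℝ, 0 < r ∧ ENNReal.ofReal t < ‖truncatedOp K r ν x‖ₑ := by
      simpa [maximalOp, lt_iSup_iff] using hx
    rw [truncatedOp_eq_sub hε hK ν hr] at hxr
    by_contra hcon
    simp only [hE, mem_union, mem_ofPred_eq, not_or, not_exists, not_and, not_lt] at hcon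
    refine absurd (enorm_sub_le.trans (add_le_add (hcon.1 r hr) (hcon.2 r hr))) (not_le.2 ?_)
    refine lt_of_le_of_lt (le_of_eq ?_) hxr
    rw [htl]
    ring
  have hbound : l * μ {x : ℂ | ENNReal.ofReal t < maximalOp K ν x} ≤
      weakOneConst ε ‖T‖ₑ * ν.totalVariation univ := by
    calc _ ≤ l * (μ (E P) + μ (E N)) := by
          gcongr
          exact (measure_mono hsub).trans (measure_union_le _ _)
      _ = l * μ (E P) + l * μ (E N) := mul_add _ _ _
      _ ≤ weakOneConst ε ‖T‖ₑ * P univ + weakOneConst ε ‖T‖ₑ * N univ :=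
          add_le_add (truncation_weak_type_one hε hμ hK hT P hl0)
            (truncation_weak_type_one hε hμ hK hT N hl0)
      _ = _ := by rw [← mul_add, SignedMeasure.totalVariation, Measure.add_apply]
  rw [ENNReal.le_div_iff_mul_le (Or.inl (ENNReal.ofReal_pos.2 ht).ne')
    (Or.inl ENNReal.ofReal_ne_top), htl]
  calc _ = 64 * (l * μ {x : ℂ | ENNReal.ofReal t < maximalOp K ν x}) := by rw [htl]; ring
    _ ≤ 64 * (weakOneConst ε ‖T‖ₑ * ν.totalVariation univ) := by gcongr
    _ = _ := by ring
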